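/- Let $L^2=L^2((-1,1)\times\mathbb R)$ (real-valued functions $f(x,t)$, Lebesgue measure $dx\,dt$), let $(\varepsilon_k)_{k\ge 0}$ be any orthonormal basis of $L^2(\mathbb R)$ (Lebesgue measure), and let $P_j$, $j\ge 0$, be the Legendre polynomials normalized in $L^2(-1,1)$. For $f\in L^2$ put $$b_{k,j}=\int_{\mathbb R}\int_{-1}^1 f(x,t)\,\varepsilon_k(t)\,P_j(x)\,dx\,dt .$$ For $n\in\mathbb N=\{0,1,2,\dots\}$ let $V_T^n\subset L^2$ be the closure of $H^n(-1,1)\otimes L^2(\mathbb R)$ (finite sums of products $u(x)v(t)$) in the norm $$\|f\|_{V_T^n}^2=\sum_{j=0}^n\int_{\mathbb R}\int_{-1}^1\Big(\frac{\partial^j f}{\partial x^j}\Big)^2(1-x^2)^j\,dx\,dt ,$$ with weak derivatives on $(-1,1)\times\mathbb R$. For $n<\eta<n+1$ let $V_T^\eta=(V_T^n,V_T^{n+1})_{\eta-n,2}$ be the real interpolation space with norm $$\|f\|_{V_T^\eta}^2=\int_0^\infty r^{-2(\eta-n)}J(r,f)^2\,\frac{dr}{r},\qquad J(r,f)=\inf_{f=v+w,\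 v\in V_T^n,\ w\in V_T^{n+1}}\big(\|v\|_{V_T^n}+r\|w\|_{V_T^{n+1}}\big).$$ (1) Let $\eta\ge 0$ be real. There are constants $c,C>0$ depending only on $\eta$ such that for every such basis and every $f\in L^2$ (with the convention $0^0=1$): $$f\in V_T^\eta\iff\sum_{k,j\ge 0}b_{k,j}^2\,j^{2\eta}<\infty ,$$ and, for $f\in V_T^\eta$, $$c\Big(\|f\|_{L^2}^2+\sum_{k,j\ge0}b_{k,j}^2\,j^{2\eta}\Big)\le\|f\|_{V_T^\eta}^2\le C\Big(\|f\|_{L^2}^2+\sum_{k,j\ge0}b_{k,j}^2\,j^{2\eta}\Big).$$ (2) Let $n\in\mathbb N$ and $f\in L^2$ (for instance a covariance kernel $f=\psi_I$ in $L^2$, whose coefficients are written $a_{k,j}=b_{k,j}$). The following are equivalent: (i) $(b_{k,j}\,j^n)_{k,j\ge0}\in\ell^2(\mathbb N^2)$; (ii) $\sum_{k\ge 0}\sum_{j\ge n}b_{k,j}^2\,j^{2n}<\infty$; (iii) the weak derivative $\partial^n f/\partial x^n$ exists on $(-1,1)\times\mathbb R$ and $\frac{\partial^n f}{\partial x^n}(1-x^2)^{n/2}\in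 L^2$; (iv) the weak derivative $\partial^n f/\partial x^n$ exists on $(-1,1)\times\mathbb R$ and $\int_{\mathbb R}\int_{-1}^1\big(\frac{\partial^n f}{\partial x^n}\big)^2(1-x^2)^n\,dx\,dt<\infty$. -/

import Mathlib

open MeasureTheory Set
open scoped ENNReal NNReal Distributions

noncomputable section

namespace KLReg

/-- The open interval `(-1, 1)`. -/
def interval : TopologicalSpace.Opens ℝ := ⟨Ioo (-1 : ℝ) 1, isOpen_Ioo⟩

/-- The open strip `(-1, 1) × ℝ`; points are written `(x, t)`. -/
def strip : TopologicalSpace.Opens (ℝ × ℝ) :=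
  ⟨Ioo (-1 : ℝ) 1 ×ˢ (univ : Set ℝ), isOpen_Ioo.prod isOpen_univ⟩

/-- Lebesgue measure `dx` on `(-1, 1)`. -/
def μI : Measure ℝ := volume.restrict (interval : Set ℝ)

/-- Lebesgue measure `dx dt` on `(-1, 1) × ℝ`. -/
def μS : Measure (ℝ × ℝ) := volume.restrict (strip : Set (ℝ × ℝ))

/-- `g` is the `j`-th weak derivative of `u` on `(-1, 1)`. -/
def IsWeakDeriv (j : ℕ) (u g : ℝ → ℝ) : Prop :=
  LocallyIntegrableOn u interval ∧ LocallyIntegrableOn g interval ∧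
    ∀ φ : 𝓓(interval, ℝ),
      ∫ x, u x * iteratedDeriv j (fun y => φ y) x ∂μI = (-1) ^ j * ∫ x, g x * φ x ∂μI

/-- `g` is the weak partial derivative `∂ʲf/∂xʲ` on `(-1, 1) × ℝ`. -/
def IsWeakDerivX (j : ℕ) (f g : ℝ × ℝ → ℝ) : Prop :=
  LocallyIntegrableOn f strip ∧ LocallyIntegrableOn g strip ∧
    ∀ φ : 𝓓(strip, ℝ),
      ∫ p, f p * iteratedDeriv j (fun y => φ (y, p.2)) p.1 ∂μS = (-1) ^ j * ∫ p, g p * φ p ∂μS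

/-- The standard Sobolev space `H^n(-1, 1)`. -/
def MemH (n : ℕ) (u : ℝ → ℝ) : Prop :=
  MemLp u 2 μI ∧ ∀ j ≤ n, ∃ g, IsWeakDeriv j u g ∧ MemLp g 2 μI

/-- The algebraic tensor product of `H^n(-1, 1)` and `L²(ℝ)`: finite sums of functions
`u(x) v(t)`. -/
def tensorHL (n : ℕ) : Submodule ℝ (ℝ × ℝ → ℝ) :=
  Submodule.span ℝ {h | ∃ u v : ℝ → ℝ, MemH n u ∧ MemLp v 2 volume ∧ h = fun p => u p.1 * v p.2}

/-- The weighted integral `∫∫ g² (1 - x²)ʲ dx dt`, with values in `[0, ∞]`. -/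
def weightedSq (j : ℕ) (g : ℝ × ℝ → ℝ) : ℝ≥0∞ :=
  ∫⁻ p, ENNReal.ofReal (g p ^ 2 * (1 - p.1 ^ 2) ^ j) ∂μS

/-- The squared seminorm `∫∫ (∂ʲf/∂xʲ)² (1 - x²)ʲ dx dt`, which is `∞` if `f` has no weak derivative
`∂ʲf/∂xʲ`. (The weak derivative is unique almost everywhere, so the infimum is over equal
values.) -/
def seminormSq (j : ℕ) (f : ℝ × ℝ → ℝ) : ℝ≥0∞ :=
  ⨅ (g : ℝ × ℝ → ℝ) (_ : IsWeakDerivX j f g), weightedSq j g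

/-- The weighted Sobolev norm of integer order `n`. -/
def normInt (n : ℕ) (f : ℝ × ℝ → ℝ) : ℝ≥0∞ :=
  (∑ j ∈ Finset.range (n + 1), seminormSq j f) ^ (1 / 2 : ℝ)

/-- The space `V_T^n`: the closure of `H^n(-1, 1) ⊗ L²(ℝ)` in the weighted norm of order `n`. -/
def MemVInt (n : ℕ) (f : ℝ × ℝ → ℝ) : Prop :=
  MemLp f 2 μS ∧ ∀ δ : ℝ≥0∞, 0 < δ → ∃ g ∈ tensorHL n, normInt n (f - g) < δ

/-- The functional `J(r, f) = inf (‖v‖_{V^n} + r ‖w‖_{V^{n+1}})` over all `f = v + w`. -/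
def Jfun (n : ℕ) (r : ℝ) (f : ℝ × ℝ → ℝ) : ℝ≥0∞ :=
  ⨅ (v : ℝ × ℝ → ℝ) (w : ℝ × ℝ → ℝ) (_ : MemVInt n v) (_ : MemVInt (n + 1) w)
    (_ : f =ᵐ[μS] v + w), normInt n v + ENNReal.ofReal r * normInt (n + 1) w

/-- The norm of the real interpolation space `(V^n, V^{n+1})_{κ, 2}`. -/
def normInterp (n : ℕ) (κ : ℝ) (f : ℝ × ℝ → ℝ) : ℝ≥0∞ :=
  (∫⁻ r in Ioi (0 : ℝ), ENNReal.ofReal (r ^ (-2 * κ)) * Jfun n r f ^ 2 * ENNReal.ofReal (1 / r)) ^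
    (1 / 2 : ℝ)

open Classical in
/-- The norm of `V_T^η` for real `η ≥ 0`, with `n` the integer part of `η`. -/
def normV (η : ℝ) (f : ℝ × ℝ → ℝ) : ℝ≥0∞ :=
  if η = (⌊η⌋₊ : ℝ) then normInt ⌊η⌋₊ f else normInterp ⌊η⌋₊ (η - ⌊η⌋₊) f

open Classical in
/-- The space `V_T^η` for real `η ≥ 0`. For `n < η < n + 1` it is the set of all `f` in
`V^n + V^{n+1} = V^n` with finite interpolation norm. -/
def MemV (η : ℝ) (f : ℝ × ℝ → ℝ) : Prop :=
  if η = (⌊η⌋₊ : ℝ) then MemVInt ⌊η⌋₊ f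
  else MemVInt ⌊η⌋₊ f ∧ normInterp ⌊η⌋₊ (η - ⌊η⌋₊) f < ∞

/-- The Legendre polynomial of degree `j` (Rodrigues' formula). -/
def legendre (j : ℕ) : Polynomial ℝ :=
  Polynomial.C (1 / (2 ^ j * (j.factorial : ℝ))) *
    Polynomial.derivative^[j] ((Polynomial.X ^ 2 - 1) ^ j)

/-- The normalized Legendre polynomial of degree `j`, of norm one in `L²(-1, 1)`. -/
def normLegendre (j : ℕ) (x : ℝ) : ℝ := √((2 * (j : ℝ) + 1) / 2) * (legendre j).eval x

/-- The coefficient `b_{k,j} = ∫∫ f(x, t) ε_k(t) P_j(x) dx dt`. -/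
def coeff (ε : HilbertBasis ℕ ℝ (Lp ℝ 2 (volume : Measure ℝ))) (f : ℝ × ℝ → ℝ) (k j : ℕ) : ℝ :=
  ∫ p, f p * (ε k : ℝ → ℝ) p.2 * normLegendre j p.1 ∂μS

/-- `∑_{k,j} b_{k,j}² j^{2η}` in `[0, ∞]`, with `0^0 = 1`. -/
def coeffSum (ε : HilbertBasis ℕ ℝ (Lp ℝ 2 (volume : Measure ℝ))) (η : ℝ) (f : ℝ × ℝ → ℝ) :
    ℝ≥0∞ :=
  ∑' q : ℕ × ℕ, ENNReal.ofReal (coeff ε f q.1 q.2 ^ 2 * (q.2 : ℝ) ^ (2 * η))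

end KLReg

end

noncomputable section

namespace KLReg

/-! The products P_j(x) ε_k(t) form a Hilbert basis of L² of the strip, and all the weighted norms
are diagonal in it. The Legendre equation, differentiated n times and put in Sturm–Liouville form,
shows that for fixed n the functions (1 - x²)^{n/2} P_j⁽ⁿ⁾ are orthogonal on (-1, 1), with squared
lengths `lam n j`, the product of j(j+1) - i(i+1) over i < n. So the squared seminorm of order n
ought to be the sum of `lam n j` b_{k,j}². `seminormSq_eq` proves this for every f in L², the value
∞ included.

One inequality is Bessel's. If g is the n-th weak x-derivative of f, integration by parts against (1
- x²)ⁿ P_j⁽ⁿ⁾ ε_k gives the coefficients of g (1 - x²)^{n/2} (`IsWeakDerivX.inner_eLp_weight`).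
These products are not test functions; they are reached by cutting off near x = ±1, where the factor
(1 - x²)ⁿ keeps n derivatives of the cutoff bounded. For the other inequality, if the sum is finite
then the series of b_{k,j} (1 - x²)^{n/2} P_j⁽ⁿ⁾ ε_k converges in L², and its quotient by (1 -
x²)^{n/2} is the weak derivative (`exists_isWeakDerivX`).

For j ≥ n, `lam n j` is comparable with (1 + j)^{2n}; for j < n it vanishes, but there the powers of
j are bounded and the L² norm controls them. This settles integer orders and part (2). For n < η < n
+ 1 the spaces of orders n and n + 1 are weighted ℓ² spaces, and J(r, f)² is comparable with the sum
of (1 + j)^{2n} min(1, r²(1 + j)²) b_{k,j}² (`wSum_kWeight_le_Jfun`, `Jfun_le`), a split at r(1 + j)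
= 1 being optimal up to a constant. Integrating in r term by term (`lintegral_min`) produces the
weight (1 + j)^{2η}. -/

/-! ### Legendre polynomials: differential equation and weighted orthogonality -/

open Polynomial in
-- With w = (X² - 1)^j, differentiating (X² - 1) w' = 2jXw gives the case m = 0, and each further
-- differentiation raises m by one.
theorem iterate_derivative_sq_sub_one_pow (j m : ℕ) :
    ((X : ℝ[X]) ^ 2 - 1) * derivative^[m + 2] ((X ^ 2 - 1) ^ j) +
      C (2 * ((m : ℝ) + 1 - j)) * X * derivative^[m + 1] ((X ^ 2 - 1) ^ j) +
      C (((m : ℝ) + 1) * (m - 2 * j)) * derivative^[m] ((X ^ 2 - 1) ^ j) = 0 := by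
  induction m with
  | zero =>
    have h : ((X : ℝ[X]) ^ 2 - 1) * derivative ((X ^ 2 - 1) ^ j) =
        2 * (j : ℝ[X]) * X * (X ^ 2 - 1) ^ j := by
      rcases j with _ | j
      · simp
      · rw [derivative_pow]
        simp
        ring
    have h2 := congrArg derivative h
    simp only [derivative_mul, derivative_sub, derivative_X_pow, derivative_one, derivative_X,
      derivative_natCast, derivative_ofNat] at h2
    simp only [Function.iterate_succ, Function.iterate_zero, Function.comp, id]
    simp [C_ofNat] at h2 ⊢
    linear_combination h2
  | succ m ih =>
    have h2 := congrArg derivative ih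
    simp only [derivative_add, derivative_mul, derivative_sub, derivative_X_pow, derivative_one,
      derivative_X, derivative_C, derivative_zero, ← Function.iterate_succ_apply'] at h2
    simp [C_ofNat] at h2 ⊢
    linear_combination h2

open Polynomial in
-- By Rodrigues' formula this is the previous identity at m = n + j, where the first-order
-- coefficient no longer depends on j.
theorem legendre_ode (n j : ℕ) :
    ((X : ℝ[X]) ^ 2 - 1) * derivative^[n + 2] (legendre j) +
      C (2 * ((n : ℝ) + 1)) * X * derivative^[n + 1] (legendre j) +
      C ((n : ℝ) * (n + 1) - j * (j + 1)) * derivative^[n] (legendre j) = 0 := by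
  have h := iterate_derivative_sq_sub_one_pow j (n + j)
  have e : ∀ k, derivative^[k] (legendre j) =
      C (1 / (2 ^ j * (j.factorial : ℝ))) * derivative^[k + j] ((X ^ 2 - 1) ^ j) := by
    intro k
    rw [legendre, iterate_derivative_C_mul, Function.iterate_add_apply]
  rw [e, e, e]
  rw [show n + 2 + j = n + j + 2 by ring, show n + 1 + j = n + j + 1 by ring]
  have c1 : (2 * (((n + j : ℕ) : ℝ) + 1 - j)) = 2 * ((n : ℝ) + 1) := by push_cast; ring
  have c2 : (((n + j : ℕ) : ℝ) + 1) * (((n + j : ℕ) : ℝ) - 2 * j) =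
      (n : ℝ) * (n + 1) - j * (j + 1) := by push_cast; ring
  rw [c1, c2] at h
  linear_combination C (1 / (2 ^ j * (j.factorial : ℝ))) * h

/-- The squared weighted norm of the `n`-th derivative of the normalized Legendre polynomial. -/
def lam (n j : ℕ) : ℝ := ∏ i ∈ Finset.range n, ((j : ℝ) * (j + 1) - i * (i + 1))

theorem lam_zero (j : ℕ) : lam 0 j = 1 := by simp [lam]

theorem lam_succ (n j : ℕ) : lam (n + 1) j = lam n j * ((j : ℝ) * (j + 1) - n * (n + 1)) :=
  Finset.prod_range_succ _ _

theorem lam_eq_zero {n j : ℕ} (h : j < n) : lam n j = 0 :=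
  Finset.prod_eq_zero (Finset.mem_range.2 h) (by ring)

theorem lam_mul_factorial (n m : ℕ) :
    lam n (n + m) * (m.factorial : ℝ) = ((2 * n + m).factorial : ℝ) := by
  induction n generalizing m with
  | zero => simp [lam_zero]
  | succ n ih =>
    have h := ih (m + 1)
    rw [lam_succ, show n + 1 + m = n + (m + 1) by ring,
      show 2 * (n + 1) + m = 2 * n + (m + 1) + 1 by ring, Nat.factorial_succ (2 * n + (m + 1)),
      Nat.cast_mul, ← h, Nat.factorial_succ m]
    push_cast
    ring

theorem lam_self (j : ℕ) : lam j j = ((2 * j).factorial : ℝ) := by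
  have := lam_mul_factorial j 0
  simpa using this

theorem lam_nonneg (n j : ℕ) : 0 ≤ lam n j := by
  rcases lt_or_ge j n with h | h
  · rw [lam_eq_zero h]
  · refine Finset.prod_nonneg fun i hi => ?_
    have hi' : (i : ℝ) ≤ j := by
      exact_mod_cast (Finset.mem_range.1 hi).le.trans h
    have : (0 : ℝ) ≤ i := by positivity
    nlinarith

open Polynomial in
-- The Sturm–Liouville form of `legendre_ode`, multiplied by -(1 - X²)ⁿ.
theorem derivative_weight_mul_legendre (n j : ℕ) :
    derivative ((1 - X ^ 2) ^ (n + 1) * derivative^[n + 1] (legendre j)) =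
      C ((n : ℝ) * (n + 1) - j * (j + 1)) * ((1 - X ^ 2) ^ n * derivative^[n] (legendre j)) := by
  have h := legendre_ode n j
  rw [derivative_mul, derivative_pow, ← Function.iterate_succ_apply' derivative]
  simp [C_ofNat] at h ⊢
  linear_combination (- (1 - X ^ 2) ^ n) * h

open Polynomial in
theorem iterate_derivative_weight_mul_legendre (n j : ℕ) :
    derivative^[n] ((1 - X ^ 2) ^ n * derivative^[n] (legendre j)) =
      C ((-1) ^ n * lam n j) * legendre j := by
  induction n with
  | zero => simp [lam_zero]
  | succ n ih =>
    rw [Function.iterate_succ_apply, derivative_weight_mul_legendre, iterate_derivative_C_mul, ih,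
      lam_succ, ← mul_assoc, ← C_mul]
    congr 2
    ring

/-- The integral of a polynomial over `(-1, 1)`. -/
def polyInt (p : Polynomial ℝ) : ℝ := ∫ x in (-1 : ℝ)..1, p.eval x

theorem polyInt_add (p q : Polynomial ℝ) : polyInt (p + q) = polyInt p + polyInt q := by
  simp only [polyInt, Polynomial.eval_add]
  exact intervalIntegral.integral_add (p.continuous.intervalIntegrable _ _)
    (q.continuous.intervalIntegrable _ _)

theorem polyInt_C_mul (c : ℝ) (p : Polynomial ℝ) :
    polyInt (Polynomial.C c * p) = c * polyInt p := by
  simp [polyInt]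

theorem polyInt_derivative (p : Polynomial ℝ) :
    polyInt (Polynomial.derivative p) = p.eval 1 - p.eval (-1) :=
  intervalIntegral.integral_eq_sub_of_hasDerivAt (fun x _ => p.hasDerivAt x)
    (p.derivative.continuous.intervalIntegrable _ _)

open Polynomial in
-- Integration by parts; the boundary terms vanish because (1 - X²)^{n+1} is zero at ±1.
theorem polyInt_ladder (p : ℝ[X]) (n j : ℕ) :
    polyInt (derivative p * ((1 - X ^ 2) ^ (n + 1) * derivative^[n + 1] (legendre j))) =
      ((j : ℝ) * (j + 1) - n * (n + 1)) *
        polyInt (p * ((1 - X ^ 2) ^ n * derivative^[n] (legendre j))) := by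
  have h := polyInt_derivative (p * ((1 - X ^ 2) ^ (n + 1) * derivative^[n + 1] (legendre j)))
  rw [derivative_mul, polyInt_add, derivative_weight_mul_legendre, mul_left_comm p,
    polyInt_C_mul] at h
  simp at h
  simp
  linear_combination h

open Polynomial in
theorem polyInt_iterate (p : ℝ[X]) (n j : ℕ) :
    polyInt (derivative^[n] p * ((1 - X ^ 2) ^ n * derivative^[n] (legendre j))) =
      lam n j * polyInt (p * legendre j) := by
  induction n with
  | zero => simp [lam_zero]
  | succ n ih =>
    rw [Function.iterate_succ_apply' derivative n p, polyInt_ladder, ih, lam_succ]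
    ring

/-- The integral of (1 - X²) P_i' P_j' is symmetric in i and j, while the ladder evaluates it with
the factor j(j+1) or i(i+1); these differ when i ≠ j. -/
theorem polyInt_legendre_of_ne {i j : ℕ} (h : i ≠ j) :
    polyInt (legendre i * legendre j) = 0 := by
  have h1 := polyInt_iterate (legendre i) 1 j
  have h2 := polyInt_iterate (legendre j) 1 i
  rw [mul_comm (legendre j) (legendre i), mul_left_comm] at h2
  rw [mul_left_comm, mul_comm (Polynomial.derivative^[1] (legendre i)), h2] at h1
  simp only [lam, Finset.prod_range_one] at h1
  have h3 : ((i : ℝ) - j) * (i + j + 1) * polyInt (legendre i * legendre j) = 0 := by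
    linear_combination h1
  have h4 : ((i : ℝ) - j) ≠ 0 := sub_ne_zero.2 (by exact_mod_cast h)
  have h5 : ((i : ℝ) + j + 1) ≠ 0 := by positivity
  simpa [h4, h5] using h3

open Polynomial in
theorem natDegree_sq_sub_one_pow (j : ℕ) : (((X : ℝ[X]) ^ 2 - 1) ^ j).natDegree = 2 * j := by
  have : ((X : ℝ[X]) ^ 2 - 1).natDegree = 2 := by
    rw [← C_1]; exact natDegree_X_pow_sub_C
  rw [natDegree_pow, this, mul_comm]

open Polynomial in
theorem iterate_derivative_self_sq_sub_one_pow (j : ℕ) :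
    derivative^[2 * j] (((X : ℝ[X]) ^ 2 - 1) ^ j) = C ((2 * j).factorial : ℝ) := by
  have hm : (((X : ℝ[X]) ^ 2 - 1) ^ j).Monic :=
    (by rw [← C_1]; exact monic_X_pow_sub_C 1 two_ne_zero : ((X : ℝ[X]) ^ 2 - 1).Monic).pow j
  have hd : (derivative^[2 * j] (((X : ℝ[X]) ^ 2 - 1) ^ j)).natDegree ≤ 0 := by
    have := natDegree_iterate_derivative (((X : ℝ[X]) ^ 2 - 1) ^ j) (2 * j)
    rwa [natDegree_sq_sub_one_pow, Nat.sub_self] at this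
  rw [eq_C_of_natDegree_le_zero hd, coeff_iterate_derivative]
  have : (((X : ℝ[X]) ^ 2 - 1) ^ j).coeff (0 + 2 * j) = 1 := by
    rw [zero_add, ← natDegree_sq_sub_one_pow j]; exact hm.coeff_natDegree
  rw [this]
  simp [Nat.descFactorial_self]

open Polynomial in
theorem iterate_derivative_legendre_self (j : ℕ) :
    derivative^[j] (legendre j) =
      C (1 / (2 ^ j * (j.factorial : ℝ)) * ((2 * j).factorial : ℝ)) := by
  rw [legendre, iterate_derivative_C_mul, ← Function.iterate_add_apply, ← two_mul,
    iterate_derivative_self_sq_sub_one_pow, C_mul]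

open Polynomial in
-- The recurrence in j comes from integrating the derivative of X (1 - X²)^{j+1}, which vanishes at
-- ±1.
theorem polyInt_weight (j : ℕ) :
    polyInt ((1 - X ^ 2) ^ j) * ((2 * j + 1).factorial : ℝ) =
      2 ^ (2 * j + 1) * (j.factorial : ℝ) ^ 2 := by
  induction j with
  | zero => simp [polyInt]; norm_num
  | succ j ih =>
    have h := polyInt_derivative ((X : ℝ[X]) * (1 - X ^ 2) ^ (j + 1))
    have e : derivative ((X : ℝ[X]) * (1 - X ^ 2) ^ (j + 1)) =
        C (2 * (j : ℝ) + 3) * (1 - X ^ 2) ^ (j + 1) + C (-(2 * (j : ℝ) + 2)) * (1 - X ^ 2) ^ j := by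
      rw [derivative_mul, derivative_pow]
      simp [C_ofNat]
      ring
    rw [e, polyInt_add, polyInt_C_mul, polyInt_C_mul] at h
    simp at h
    rw [show 2 * (j + 1) + 1 = (2 * j + 1) + 1 + 1 by ring, Nat.factorial_succ (2 * j + 1 + 1),
      Nat.factorial_succ (2 * j + 1), Nat.factorial_succ j]
    push_cast
    linear_combination (2 * (j : ℝ) + 2) * (2 * j + 1).factorial * h + (2 * (j : ℝ) + 2) ^ 2 * ih

/-- After j ladder steps P_j⁽ʲ⁾ is constant, so only the integral of (1 - x²)^j remains. -/
theorem polyInt_legendre_self (j : ℕ) :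
    polyInt (legendre j * legendre j) = 2 / (2 * (j : ℝ) + 1) := by
  have h := polyInt_iterate (legendre j) j j
  rw [iterate_derivative_legendre_self, polyInt_C_mul, mul_comm _ (Polynomial.C _), polyInt_C_mul, lam_self] at h
  have hw := polyInt_weight j
  rw [Nat.factorial_succ] at hw
  push_cast at hw
  have f1 : ((2 * j).factorial : ℝ) ≠ 0 := by positivity
  have f2 : (j.factorial : ℝ) ≠ 0 := by positivity
  have f3 : (2 * (j : ℝ) + 1) ≠ 0 := by positivity
  rw [eq_div_iff f3]
  apply mul_left_cancel₀ f1
  rw [← mul_assoc, ← h]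
  field_simp
  have e2 : (2 : ℝ) ^ (2 * j + 1) = (2 ^ j) ^ 2 * 2 := by ring
  rw [e2] at hw
  linear_combination hw

/-- The normalized Legendre polynomials, as polynomials. -/
def nleg (j : ℕ) : Polynomial ℝ := Polynomial.C √((2 * (j : ℝ) + 1) / 2) * legendre j

theorem eval_nleg (j : ℕ) (x : ℝ) : (nleg j).eval x = normLegendre j x := by
  simp [nleg, normLegendre]

theorem polyInt_nleg (i j : ℕ) : polyInt (nleg i * nleg j) = if i = j then 1 else 0 := by
  have e : nleg i * nleg j = Polynomial.C (√((2 * (i : ℝ) + 1) / 2) * √((2 * (j : ℝ) + 1) / 2)) *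
      (legendre i * legendre j) := by
    rw [nleg, nleg, Polynomial.C_mul]; ring
  rw [e, polyInt_C_mul]
  split_ifs with h
  · subst h
    rw [polyInt_legendre_self, Real.mul_self_sqrt (by positivity)]
    field_simp
  · rw [polyInt_legendre_of_ne h, mul_zero]

open Polynomial in
theorem polyInt_nleg_iterate (n i j : ℕ) :
    polyInt (derivative^[n] (nleg i) * ((1 - X ^ 2) ^ n * derivative^[n] (nleg j))) =
      if i = j then lam n j else 0 := by
  have h := polyInt_iterate (nleg i) n j
  have h2 := polyInt_nleg i j
  rw [nleg, nleg, mul_left_comm, polyInt_C_mul, ← nleg] at h2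
  rw [nleg.eq_def j, iterate_derivative_C_mul, mul_left_comm _ (C _), mul_left_comm _ (C _),
    polyInt_C_mul, h, mul_left_comm, h2]
  split_ifs <;> simp

open Polynomial in
theorem iterate_derivative_weight_mul_nleg (n j : ℕ) :
    derivative^[n] ((1 - X ^ 2) ^ n * derivative^[n] (nleg j)) =
      C ((-1) ^ n * lam n j) * nleg j := by
  rw [nleg, iterate_derivative_C_mul, mul_left_comm, iterate_derivative_C_mul,
    iterate_derivative_weight_mul_legendre, mul_left_comm]

open Polynomial in
theorem natDegree_iterate_derivative_eq (p : ℝ[X]) (k : ℕ) :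
    (derivative^[k] p).natDegree = p.natDegree - k := by
  induction k with
  | zero => simp
  | succ k ih => rw [Function.iterate_succ_apply', natDegree_derivative, ih, Nat.sub_sub]

open Polynomial in
theorem natDegree_nleg (j : ℕ) : (nleg j).natDegree = j := by
  have h1 : √((2 * (j : ℝ) + 1) / 2) ≠ 0 := by positivity
  have h2 : 1 / (2 ^ j * (j.factorial : ℝ)) ≠ 0 := by positivity
  rw [nleg, legendre, natDegree_C_mul h1, natDegree_C_mul h2, natDegree_iterate_derivative_eq,
    natDegree_sq_sub_one_pow]
  lia

open Polynomial in
-- There is one polynomial of each degree exactly.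
theorem span_nleg : Submodule.span ℝ (Set.range nleg) = ⊤ := by
  have hne : ∀ j, nleg j ≠ 0 := by
    intro j h
    have := polyInt_nleg j j
    simp [h, polyInt] at this
  let S : Polynomial.Sequence ℝ :=
    ⟨nleg, fun j => by rw [degree_eq_natDegree (hne j), natDegree_nleg]⟩
  exact S.span fun i => isUnit_iff_ne_zero.2 (leadingCoeff_ne_zero.2 (hne i))

/-! ### Square-integrable functions on the strip, their slices and marginals -/

theorem μS_eq_prod : μS = μI.prod volume := by
  simp only [μS, μI, strip, interval, TopologicalSpace.Opens.coe_mk]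
  rw [Measure.volume_eq_prod, ← Measure.prod_restrict, Measure.restrict_univ]

instance : IsFiniteMeasure μI :=
  ⟨by simp [μI, interval]⟩

instance : SigmaFinite μS := by
  rw [μS_eq_prod]; infer_instance

theorem integral_μI (u : ℝ → ℝ) : ∫ x, u x ∂μI = ∫ x in (-1 : ℝ)..1, u x := by
  rw [intervalIntegral.integral_of_le (by norm_num), integral_Ioc_eq_integral_Ioo]
  rfl

theorem ae_μI : ∀ᵐ x ∂μI, x ∈ Ioo (-1 : ℝ) 1 :=
  ae_restrict_mem measurableSet_Ioo

theorem ae_μS : ∀ᵐ p ∂μS, p.1 ∈ Ioo (-1 : ℝ) 1 := by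
  filter_upwards [ae_restrict_mem (μ := volume) strip.isOpen.measurableSet] with p hp
  exact hp.1

theorem memLp_of_continuous {u : ℝ → ℝ} (hu : Continuous u) : MemLp u 2 μI := by
  obtain ⟨C, hC⟩ := isCompact_Icc.exists_bound_of_continuousOn (s := Icc (-1 : ℝ) 1) hu.continuousOn
  refine MemLp.of_bound hu.aestronglyMeasurable C ?_
  filter_upwards [ae_μI] with x hx using hC x ⟨hx.1.le, hx.2.le⟩

theorem memLp_tensor {u v : ℝ → ℝ} (hu : MemLp u 2 μI) (hv : MemLp v 2 volume) :
    MemLp (fun p : ℝ × ℝ => u p.1 * v p.2) 2 μS := by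
  rw [μS_eq_prod]
  have hm : AEStronglyMeasurable (fun p : ℝ × ℝ => u p.1 * v p.2) (μI.prod volume) :=
    hu.1.comp_fst.mul hv.1.comp_snd
  rw [memLp_two_iff_integrable_sq hm]
  refine (hu.integrable_sq.mul_prod hv.integrable_sq).congr (Filter.Eventually.of_forall fun p => ?_)
  simp only
  ring

theorem integral_tensor (u v : ℝ → ℝ) :
    ∫ p, u p.1 * v p.2 ∂μS = (∫ x, u x ∂μI) * ∫ t, v t := by
  rw [μS_eq_prod, integral_prod_mul]

theorem inner_toLp {f g : ℝ × ℝ → ℝ} (hf : MemLp f 2 μS) (hg : MemLp g 2 μS) :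
    inner ℝ (hf.toLp f) (hg.toLp g) = ∫ p, f p * g p ∂μS := by
  rw [L2.inner_def]
  refine integral_congr_ae ?_
  filter_upwards [hf.coeFn_toLp, hg.coeFn_toLp] with p h1 h2
  rw [h1, h2]
  simp [mul_comm]

theorem norm_toLp_sq {f : ℝ × ℝ → ℝ} (hf : MemLp f 2 μS) :
    ‖hf.toLp f‖ ^ 2 = ∫ p, f p ^ 2 ∂μS := by
  rw [← real_inner_self_eq_norm_sq, inner_toLp]
  simp only [sq]

theorem eLpNorm_sq {f : ℝ × ℝ → ℝ} (hf : MemLp f 2 μS) :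
    eLpNorm f 2 μS ^ 2 = ENNReal.ofReal (∫ p, f p ^ 2 ∂μS) := by
  rw [← norm_toLp_sq hf, Lp.norm_toLp, ENNReal.ofReal_pow ENNReal.toReal_nonneg,
    ENNReal.ofReal_toReal hf.2.ne]

theorem integrable_mul {f g : ℝ × ℝ → ℝ} (hf : MemLp f 2 μS) (hg : MemLp g 2 μS) :
    Integrable (fun p => f p * g p) μS :=
  MemLp.integrable_mul hf hg

/-- A bounded continuous function of `x` times a square-integrable function. -/
theorem memLp_mul_continuous {f : ℝ × ℝ → ℝ} (hf : MemLp f 2 μS) {u : ℝ → ℝ} (hu : Continuous u) :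
    MemLp (fun p => f p * u p.1) 2 μS := by
  obtain ⟨C, hC⟩ := isCompact_Icc.exists_bound_of_continuousOn (s := Icc (-1 : ℝ) 1) hu.continuousOn
  have hm : AEStronglyMeasurable (fun p : ℝ × ℝ => u p.1) μS :=
    (hu.comp continuous_fst).aestronglyMeasurable
  refine MemLp.of_le_mul (c := C) hf (hf.1.mul hm) ?_
  filter_upwards [ae_μS] with p hp
  rw [norm_mul, mul_comm]
  exact mul_le_mul_of_nonneg_right (hC _ ⟨hp.1.le, hp.2.le⟩) (norm_nonneg _)

theorem ae_memLp_slice {h : ℝ × ℝ → ℝ} (hh : MemLp h 2 μS) :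
    ∀ᵐ t : ℝ, MemLp (fun x => h (x, t)) 2 μI := by
  rw [μS_eq_prod] at hh
  have h1 := hh.1.prod_swap.prodMk_left
  have h2 := hh.integrable_sq.prod_left_ae
  filter_upwards [h1, h2] with t h3 h4
  exact (memLp_two_iff_integrable_sq h3).2 h4

/-- Cauchy–Schwarz on an interval of length 2: expand the integral of (u - c/2)², where c/2 is the
mean of u. -/
theorem sq_integral_μI_le {u : ℝ → ℝ} (hu : MemLp u 2 μI) :
    (∫ x, u x ∂μI) ^ 2 ≤ 2 * ∫ x, u x ^ 2 ∂μI := by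
  have h1 : Integrable u μI := hu.integrable (by norm_num)
  have h2 := hu.integrable_sq
  set c := ∫ x, u x ∂μI with hc
  have h3 : 0 ≤ ∫ x, (u x - c / 2) ^ 2 ∂μI := integral_nonneg fun x => sq_nonneg _
  have e : (fun x => (u x - c / 2) ^ 2) = fun x => (u x ^ 2 - c * u x) + c ^ 2 / 4 := by
    ext x; ring
  have hv : μI.real univ = 2 := by
    simp [μI, interval, Measure.real]
    norm_num
  have h4 : Integrable (fun x => u x ^ 2 - c * u x) μI := h2.sub (h1.const_mul c)
  rw [e, integral_add h4 (integrable_const _),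
    integral_sub h2 (h1.const_mul c), integral_const_mul, ← hc, integral_const, hv] at h3
  simp at h3
  nlinarith

theorem memLp_marginal {h : ℝ × ℝ → ℝ} (hh : MemLp h 2 μS) :
    MemLp (fun t => ∫ x, h (x, t) ∂μI) 2 volume := by
  have hs := ae_memLp_slice hh
  rw [μS_eq_prod] at hh
  have hm : AEStronglyMeasurable (fun t => ∫ x, h (x, t) ∂μI) volume :=
    hh.1.prod_swap.integral_prod_right'
  rw [memLp_two_iff_integrable_sq hm]
  refine Integrable.mono' ((hh.integrable_sq.integral_prod_right).const_mul 2) (hm.pow 2) ?_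
  filter_upwards [hs] with t ht
  rw [Real.norm_of_nonneg (sq_nonneg _)]
  exact sq_integral_μI_le ht

theorem memLp_mul_snd_integrable {h : ℝ × ℝ → ℝ} (hh : MemLp h 2 μS) {v : ℝ → ℝ}
    (hv : MemLp v 2 volume) : Integrable (fun p => h p * v p.2) μS := by
  have := memLp_tensor (memLp_of_continuous (continuous_const (y := (1 : ℝ)))) hv
  simpa using integrable_mul hh this

theorem integral_mul_snd {h : ℝ × ℝ → ℝ} (hh : MemLp h 2 μS) {v : ℝ → ℝ}
    (hv : MemLp v 2 volume) :
    ∫ p, h p * v p.2 ∂μS = ∫ t, (∫ x, h (x, t) ∂μI) * v t := by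
  have := memLp_mul_snd_integrable hh hv
  rw [μS_eq_prod] at this ⊢
  rw [integral_prod_symm _ this]
  simp only [integral_mul_const]

/-! ### Completeness and the product basis of the strip -/

theorem ae_eq_zero_of_polynomial {u : ℝ → ℝ} (hu : Integrable u μI)
    (h : ∀ p : Polynomial ℝ, ∫ x, u x * p.eval x ∂μI = 0) : ∀ᵐ x ∂μI, u x = 0 := by
  refine ae_eq_zero_of_integral_contDiff_smul_eq_zero hu.locallyIntegrable fun φ hφ _ => ?_
  have hc := hφ.continuous
  by_contra hne
  set c := ∫ x, φ x • u x ∂μI with hc'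
  have hI : 0 ≤ ∫ x, ‖u x‖ ∂μI := integral_nonneg fun _ => norm_nonneg _
  -- Weierstrass accuracy chosen so that replacing φ by a polynomial costs at most |c|/2, which
  -- contradicts c ≠ 0; the +1 covers a vanishing L¹ norm.
  have hpos : 0 < |c| / (2 * ((∫ x, ‖u x‖ ∂μI) + 1)) := by positivity
  obtain ⟨p, hp⟩ := exists_polynomial_near_of_continuousOn (-1) 1 φ hc.continuousOn _ hpos
  have hbd : ∀ q : ℝ → ℝ, Continuous q → Integrable (fun x => u x * q x) μI := by
    intro q hq
    obtain ⟨C, hC⟩ :=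
      isCompact_Icc.exists_bound_of_continuousOn (s := Icc (-1 : ℝ) 1) hq.continuousOn
    refine hu.mul_bdd (c := C) hq.aestronglyMeasurable ?_
    filter_upwards [ae_μI] with x hx using hC x ⟨hx.1.le, hx.2.le⟩
  have e : c = ∫ x, u x * (φ x - p.eval x) ∂μI := by
    simp only [mul_sub]
    rw [integral_sub (hbd _ hc) (hbd _ p.continuous), h, sub_zero, hc']
    simp only [smul_eq_mul, mul_comm]
  have hle : |c| ≤ |c| / (2 * ((∫ x, ‖u x‖ ∂μI) + 1)) * ∫ x, ‖u x‖ ∂μI := by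
    nth_rewrite 1 [e]
    rw [← integral_const_mul, ← Real.norm_eq_abs]
    refine norm_integral_le_of_norm_le (hu.norm.const_mul _) ?_
    filter_upwards [ae_μI] with x hx
    rw [norm_mul, mul_comm, Real.norm_eq_abs (_ - _), abs_sub_comm]
    exact mul_le_mul_of_nonneg_right (hp x ⟨hx.1.le, hx.2.le⟩).le (norm_nonneg _)
  have hcpos : 0 < |c| := abs_pos.2 hne
  rw [div_mul_eq_mul_div, le_div_iff₀ (by positivity)] at hle
  nlinarith

/-- The functions `P_j⁽ⁿ⁾(x) (1 - x²)^{n/2}`. -/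
def legFun (n j : ℕ) (x : ℝ) : ℝ :=
  (Polynomial.derivative^[n] (nleg j)).eval x * √(1 - x ^ 2) ^ n

theorem continuous_sqrt_weight (n : ℕ) : Continuous fun x : ℝ => √(1 - x ^ 2) ^ n := by
  fun_prop

theorem continuous_legFun (n j : ℕ) : Continuous (legFun n j) :=
  (Polynomial.continuous _).mul (continuous_sqrt_weight n)

theorem legFun_zero (j : ℕ) (x : ℝ) : legFun 0 j x = normLegendre j x := by
  simp [legFun, eval_nleg]

theorem sqrt_weight_sq {x : ℝ} (hx : x ∈ Ioo (-1 : ℝ) 1) (n : ℕ) :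
    √(1 - x ^ 2) ^ n * √(1 - x ^ 2) ^ n = (1 - x ^ 2) ^ n := by
  rw [← mul_pow, Real.mul_self_sqrt (by nlinarith [hx.1, hx.2])]

theorem integral_legFun (n i j : ℕ) :
    ∫ x, legFun n i x * legFun n j x ∂μI = if i = j then lam n j else 0 := by
  rw [← polyInt_nleg_iterate, polyInt, ← integral_μI]
  refine integral_congr_ae ?_
  filter_upwards [ae_μI] with x hx
  simp only [legFun, Polynomial.eval_mul, Polynomial.eval_pow, Polynomial.eval_sub,
    Polynomial.eval_one, Polynomial.eval_X]
  rw [← sqrt_weight_sq hx]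
  ring

section Basis

variable (ε : HilbertBasis ℕ ℝ (Lp ℝ 2 (volume : Measure ℝ)))

/-- The functions `P_j⁽ⁿ⁾(x) (1 - x²)^{n/2} ε_k(t)`, for `q = (k, j)`. -/
def eFun (n : ℕ) (q : ℕ × ℕ) (p : ℝ × ℝ) : ℝ := legFun n q.2 p.1 * (ε q.1 : ℝ → ℝ) p.2

theorem memLp_eFun (n : ℕ) (q : ℕ × ℕ) : MemLp (eFun ε n q) 2 μS :=
  memLp_tensor (memLp_of_continuous (continuous_legFun n q.2)) (Lp.memLp _)

/-- `eFun` as an element of `L²`. -/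
def eLp (n : ℕ) (q : ℕ × ℕ) : Lp ℝ 2 μS := (memLp_eFun ε n q).toLp _

theorem integral_basis (k l : ℕ) :
    ∫ t, (ε k : ℝ → ℝ) t * (ε l : ℝ → ℝ) t = if k = l then 1 else 0 := by
  have h := orthonormal_iff_ite.1 ε.orthonormal k l
  rw [L2.inner_def] at h
  rw [← h]
  simp [mul_comm]

theorem inner_eLp (n : ℕ) (q r : ℕ × ℕ) :
    inner ℝ (eLp ε n q) (eLp ε n r) = if q = r then lam n r.2 else 0 := by
  rw [eLp, eLp, inner_toLp]
  have e : (fun p => eFun ε n q p * eFun ε n r p) = fun p : ℝ × ℝ =>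
      (fun x => legFun n q.2 x * legFun n r.2 x) p.1 *
        (fun t => (ε q.1 : ℝ → ℝ) t * (ε r.1 : ℝ → ℝ) t) p.2 := by
    ext p; simp only [eFun]; ring
  rw [e]
  refine (integral_tensor (fun x => legFun n q.2 x * legFun n r.2 x)
    fun t => (ε q.1 : ℝ → ℝ) t * (ε r.1 : ℝ → ℝ) t).trans ?_
  rw [integral_legFun, integral_basis]
  rcases q with ⟨a, b⟩
  rcases r with ⟨c, d⟩
  simp only [Prod.mk.injEq]
  split_ifs <;> simp_all

theorem orthonormal_eLp : Orthonormal ℝ (eLp ε 0) := by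
  rw [orthonormal_iff_ite]
  intro q r
  rw [inner_eLp, lam_zero]

theorem marginal_eq_zero {h : ℝ × ℝ → ℝ} (hh : MemLp h 2 μS)
    (h0 : ∀ k, ∫ p, h p * (ε k : ℝ → ℝ) p.2 ∂μS = 0) : ∀ᵐ t, ∫ x, h (x, t) ∂μI = 0 := by
  have hF := memLp_marginal hh
  have : hF.toLp _ = 0 := by
    apply ε.repr.injective
    ext k
    rw [ε.repr_apply_apply, map_zero, L2.inner_def]
    simp only [lp.coeFn_zero, Pi.zero_apply]
    rw [← h0 k, integral_mul_snd hh (Lp.memLp _)]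
    refine integral_congr_ae ?_
    filter_upwards [hF.coeFn_toLp] with t ht
    rw [ht]
    simp
  have h2 := hF.coeFn_toLp
  rw [this] at h2
  filter_upwards [h2, Lp.coeFn_zero ℝ 2 (volume : Measure ℝ)] with t h3 h4
  rw [← h3, h4]; rfl

theorem integral_sq_eq_zero_of_slices {f : ℝ × ℝ → ℝ} (hf : MemLp f 2 μS)
    (h : ∀ᵐ t : ℝ, ∀ᵐ x ∂μI, f (x, t) = 0) : ∫ p, f p ^ 2 ∂μS = 0 := by
  have hi := hf.integrable_sq
  rw [μS_eq_prod] at hi ⊢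
  rw [integral_prod_symm _ hi]
  refine integral_eq_zero_of_ae ?_
  filter_upwards [h] with t ht
  refine integral_eq_zero_of_ae ?_
  filter_upwards [ht] with x hx
  simp [hx]

/-- For each j the function t ↦ ∫ h(x, t) P_j(x) dx is in L²(ℝ) and orthogonal to every ε_k, hence
zero almost everywhere. Since there are countably many j, almost every slice is orthogonal to all
polynomials. -/
theorem eq_zero_of_inner_eLp (h : Lp ℝ 2 μS) (h0 : ∀ q, inner ℝ (eLp ε 0 q) h = 0) : h = 0 := by
  have hh := Lp.memLp h
  have hj : ∀ j, ∀ᵐ t : ℝ, ∫ x, h (x, t) * (nleg j).eval x ∂μI = 0 := by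
    intro j
    refine marginal_eq_zero ε (memLp_mul_continuous hh (nleg j).continuous) fun k => ?_
    have := h0 (k, j)
    rw [← Lp.toLp_coeFn h hh, eLp, inner_toLp] at this
    rw [← this]
    congr 1
    ext p
    simp only [eFun, legFun, Function.iterate_zero, id, pow_zero, mul_one]
    ring
  have hz : ∀ᵐ t : ℝ, ∀ᵐ x ∂μI, h (x, t) = 0 := by
    filter_upwards [ae_all_iff.2 hj, ae_memLp_slice hh] with t h1 h2
    have hi : Integrable (fun x => h (x, t)) μI := h2.integrable (by norm_num)
    refine ae_eq_zero_of_polynomial hi fun p => ?_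
    have hp : p ∈ Submodule.span ℝ (Set.range nleg) := by rw [span_nleg]; trivial
    have hint : ∀ p : Polynomial ℝ, Integrable (fun x => h (x, t) * p.eval x) μI := fun p =>
      MemLp.integrable_mul h2 (memLp_of_continuous p.continuous)
    induction hp using Submodule.span_induction with
    | mem p hp => obtain ⟨j, rfl⟩ := hp; exact h1 j
    | zero => simp
    | add p q _ _ hp hq =>
      simp only [Polynomial.eval_add, mul_add]
      rw [integral_add (hint p) (hint q), hp, hq, add_zero]
    | smul a p _ hp =>
      simp only [Polynomial.eval_smul, smul_eq_mul, mul_left_comm _ a]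
      rw [integral_const_mul, hp, mul_zero]
  have hn := norm_toLp_sq hh
  rw [Lp.toLp_coeFn h hh] at hn
  rw [integral_sq_eq_zero_of_slices hh hz] at hn
  simpa using hn

/-- The Hilbert basis `P_j(x) ε_k(t)` of `L²` of the strip. -/
def stripBasis : HilbertBasis (ℕ × ℕ) ℝ (Lp ℝ 2 μS) :=
  HilbertBasis.mkOfOrthogonalEqBot (orthonormal_eLp ε) (by
    rw [Submodule.eq_bot_iff]
    intro h hh
    refine eq_zero_of_inner_eLp ε h fun q => ?_
    exact (Submodule.mem_orthogonal _ _).1 hh _ (Submodule.subset_span ⟨q, rfl⟩))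

theorem coe_stripBasis : ⇑(stripBasis ε) = eLp ε 0 := HilbertBasis.coe_mkOfOrthogonalEqBot _ _

theorem coeff_eq_inner {f : ℝ × ℝ → ℝ} (hf : MemLp f 2 μS) (q : ℕ × ℕ) :
    coeff ε f q.1 q.2 = inner ℝ (eLp ε 0 q) (hf.toLp f) := by
  rw [eLp, inner_toLp, coeff]
  congr 1
  ext p
  simp only [eFun, legFun_zero]
  ring

theorem hasSum_coeff_mul_inner {f : ℝ × ℝ → ℝ} (hf : MemLp f 2 μS) (h : Lp ℝ 2 μS) :
    HasSum (fun q : ℕ × ℕ => coeff ε f q.1 q.2 * inner ℝ (eLp ε 0 q) h)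
      (inner ℝ (hf.toLp f) h) := by
  have := (stripBasis ε).hasSum_inner_mul_inner (hf.toLp f) h
  simp only [coe_stripBasis] at this
  simpa only [coeff_eq_inner ε hf, real_inner_comm] using this

theorem tsum_coeff_sq {f : ℝ × ℝ → ℝ} (hf : MemLp f 2 μS) :
    ∑' q : ℕ × ℕ, ENNReal.ofReal (coeff ε f q.1 q.2 ^ 2) = eLpNorm f 2 μS ^ 2 := by
  have h := hasSum_coeff_mul_inner ε hf (hf.toLp f)
  simp only [← coeff_eq_inner ε hf, ← sq, real_inner_self_eq_norm_sq] at h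
  rw [eLpNorm_sq hf, ← norm_toLp_sq hf, ← h.tsum_eq,
    ENNReal.ofReal_tsum_of_nonneg (fun _ => sq_nonneg _) h.summable]

end Basis

/-! ### Test functions, and weak derivatives of tensor products and polynomials -/

/-- The partial derivative in the first variable. -/
def dx (φ : ℝ × ℝ → ℝ) (p : ℝ × ℝ) : ℝ := fderiv ℝ φ p (1, 0)

open scoped ContDiff in
theorem contDiff_dx {φ : ℝ × ℝ → ℝ} (h : ContDiff ℝ ∞ φ) : ContDiff ℝ ∞ (dx φ) :=
  (h.fderiv_right (m := ∞) (by simp)).clm_apply contDiff_const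

theorem hasCompactSupport_dx {φ : ℝ × ℝ → ℝ} (h : HasCompactSupport φ) :
    HasCompactSupport (dx φ) :=
  h.fderiv_apply ℝ (1, 0)

open scoped ContDiff in
theorem deriv_slice {φ : ℝ × ℝ → ℝ} (h : ContDiff ℝ ∞ φ) (t : ℝ) :
    deriv (fun y => φ (y, t)) = fun x => dx φ (x, t) := by
  ext x
  have h1 : HasFDerivAt φ (fderiv ℝ φ (x, t)) (x, t) :=
    (h.differentiable (by simp) _).hasFDerivAt
  exact (h1.comp_hasDerivAt x ((hasDerivAt_id x).prodMk (hasDerivAt_const x t))).deriv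

open scoped ContDiff in
theorem exists_iteratedDeriv_slice {φ : ℝ × ℝ → ℝ} (h : ContDiff ℝ ∞ φ) (hc : HasCompactSupport φ)
    (n : ℕ) : ∃ ψ : ℝ × ℝ → ℝ, ContDiff ℝ ∞ ψ ∧ HasCompactSupport ψ ∧
      ∀ p : ℝ × ℝ, iteratedDeriv n (fun y => φ (y, p.2)) p.1 = ψ p := by
  induction n generalizing φ with
  | zero => exact ⟨φ, h, hc, fun p => by simp⟩
  | succ n ih =>
    obtain ⟨ψ, h1, h2, h3⟩ := ih (contDiff_dx h) (hasCompactSupport_dx hc)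
    refine ⟨ψ, h1, h2, fun p => ?_⟩
    rw [iteratedDeriv_succ', deriv_slice h, h3]

theorem memLp_testFunction_deriv (φ : 𝓓(strip, ℝ)) (n : ℕ) :
    MemLp (fun p : ℝ × ℝ => iteratedDeriv n (fun y => φ (y, p.2)) p.1) 2 μS := by
  obtain ⟨ψ, h1, h2, h3⟩ := exists_iteratedDeriv_slice φ.contDiff φ.hasCompactSupport n
  simp only [h3]
  have : IsFiniteMeasureOnCompacts μS := by unfold μS; infer_instance
  exact h1.continuous.memLp_of_hasCompactSupport h2

theorem memLp_testFunction (φ : 𝓓(strip, ℝ)) : MemLp (fun p => φ p) 2 μS := by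
  simpa using memLp_testFunction_deriv φ 0

theorem locallyIntegrableOn_of_memLp {f : ℝ × ℝ → ℝ} (hf : MemLp f 2 μS) :
    LocallyIntegrableOn f strip := by
  have : IsLocallyFiniteMeasure μS := by unfold μS; infer_instance
  exact locallyIntegrableOn_of_locallyIntegrable_restrict (hf.locallyIntegrable (by norm_num))

theorem locallyIntegrableOn_of_memLp_interval {u : ℝ → ℝ} (hu : MemLp u 2 μI) :
    LocallyIntegrableOn u interval :=
  locallyIntegrableOn_of_locallyIntegrable_restrict (μ := volume)
    (Integrable.locallyIntegrable (hu.integrable (by norm_num)))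

/-- The restriction of a test function on the strip to a horizontal line. -/
def sliceTest (φ : 𝓓(strip, ℝ)) (t : ℝ) : 𝓓(interval, ℝ) where
  toFun x := φ (x, t)
  contDiff' := φ.contDiff.comp (contDiff_id.prodMk contDiff_const)
  hasCompactSupport' := by
    refine HasCompactSupport.intro (K := Prod.fst '' tsupport φ)
      (φ.hasCompactSupport.isCompact.image continuous_fst) fun x hx => ?_
    by_contra h
    exact hx ⟨(x, t), subset_tsupport _ h, rfl⟩
  tsupport_subset' := by
    have h1 : tsupport (fun x => φ (x, t)) ⊆ (fun x => (x, t)) ⁻¹' tsupport φ :=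
      closure_minimal (fun x hx => subset_tsupport φ hx)
        ((isClosed_tsupport φ).preimage (by fun_prop))
    exact fun x hx => (φ.tsupport_subset (h1 hx)).1

/-- By Fubini, the one-dimensional identity is applied on each line, to the restriction of the test
function. -/
theorem isWeakDerivX_tensor {n : ℕ} {u u' v : ℝ → ℝ} (h : IsWeakDeriv n u u') (hu : MemLp u 2 μI)
    (hu' : MemLp u' 2 μI) (hv : MemLp v 2 volume) :
    IsWeakDerivX n (fun p => u p.1 * v p.2) (fun p => u' p.1 * v p.2) := by
  have h1 := memLp_tensor hu hv
  have h2 := memLp_tensor hu' hv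
  refine ⟨locallyIntegrableOn_of_memLp h1, locallyIntegrableOn_of_memLp h2, fun φ => ?_⟩
  have i1 := integrable_mul h1 (memLp_testFunction_deriv φ n)
  have i2 := integrable_mul h2 (memLp_testFunction φ)
  rw [μS_eq_prod] at i1 i2 ⊢
  rw [integral_prod_symm _ i1, integral_prod_symm _ i2, ← integral_const_mul]
  congr 1
  ext t
  have := h.2.2 (sliceTest φ t)
  simp only [mul_right_comm _ (v t)]
  rw [integral_mul_const, integral_mul_const, ← mul_assoc]
  congr 1

open scoped ContDiff in
theorem contDiff_iteratedDeriv {φ : ℝ → ℝ} (h : ContDiff ℝ ∞ φ) (n : ℕ) :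
    ContDiff ℝ ∞ (iteratedDeriv n φ) := by
  induction n with
  | zero => simpa using h
  | succ n ih => rw [iteratedDeriv_succ]; exact (contDiff_infty_iff_deriv.1 ih).2

theorem tsupport_iteratedDeriv (φ : ℝ → ℝ) (n : ℕ) :
    tsupport (iteratedDeriv n φ) ⊆ tsupport φ := by
  induction n with
  | zero => simp
  | succ n ih =>
    rw [iteratedDeriv_succ]
    exact (closure_minimal support_deriv_subset (isClosed_tsupport _)).trans ih

open scoped ContDiff in
theorem integral_poly_mul_iteratedDeriv (p : Polynomial ℝ) (n : ℕ) {φ : ℝ → ℝ} (h : ContDiff ℝ ∞ φ)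
    (hc : HasCompactSupport φ) : ∫ x, p.eval x * iteratedDeriv n φ x =
      (-1) ^ n * ∫ x, (Polynomial.derivative^[n] p).eval x * φ x := by
  induction n generalizing p with
  | zero => simp
  | succ n ih =>
    have hd : ContDiff ℝ ∞ (iteratedDeriv n φ) := contDiff_iteratedDeriv h n
    have hs : HasCompactSupport (iteratedDeriv n φ) := hc.of_isClosed_subset (isClosed_tsupport _) (tsupport_iteratedDeriv φ n)
    have hs' : HasCompactSupport (deriv (iteratedDeriv n φ)) := hs.deriv
    have int : ∀ (q : Polynomial ℝ) (ψ : ℝ → ℝ), Continuous ψ → HasCompactSupport ψ →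
        Integrable ((fun x => q.eval x) * ψ) := fun q ψ h1 h2 =>
      (q.continuous.mul h1).integrable_of_hasCompactSupport h2.mul_left
    rw [iteratedDeriv_succ]
    rw [integral_mul_deriv_eq_deriv_mul_of_integrable (fun x _ => p.hasDerivAt x)
      (fun x _ => (hd.differentiable (by simp) x).hasDerivAt)
      (int p _ (hd.continuous_deriv (by simp)) hs') (int p.derivative _ hd.continuous hs)
      (int p _ hd.continuous hs), ih, Function.iterate_succ_apply]
    ring

theorem isWeakDeriv_poly (p : Polynomial ℝ) (n : ℕ) :
    IsWeakDeriv n (fun x => p.eval x) (fun x => (Polynomial.derivative^[n] p).eval x) := by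
  refine ⟨locallyIntegrableOn_of_memLp_interval (memLp_of_continuous (Polynomial.continuous _)),
    locallyIntegrableOn_of_memLp_interval (memLp_of_continuous (Polynomial.continuous _)),
    fun φ => ?_⟩
  have h := integral_poly_mul_iteratedDeriv p n φ.contDiff φ.hasCompactSupport
  have h0 : ∀ x ∉ (interval : Set ℝ), φ x = 0 := fun x hx =>
    image_eq_zero_of_notMem_tsupport fun h => hx (φ.tsupport_subset h)
  have h1 : ∀ x ∉ (interval : Set ℝ), iteratedDeriv n (fun y => φ y) x = 0 := fun x hx => by
    by_contra hne
    exact hx (φ.tsupport_subset (tsupport_iteratedDeriv _ n (subset_tsupport _ hne)))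
  rw [μI, setIntegral_eq_integral_of_forall_compl_eq_zero fun x hx => by rw [h1 x hx, mul_zero],
    setIntegral_eq_integral_of_forall_compl_eq_zero fun x hx => by rw [h0 x hx, mul_zero]]
  exact h

theorem memH_poly (p : Polynomial ℝ) (n : ℕ) : MemH n fun x => p.eval x :=
  ⟨memLp_of_continuous p.continuous, fun j _ =>
    ⟨_, isWeakDeriv_poly p j, memLp_of_continuous (Polynomial.continuous _)⟩⟩

/-! ### Cutoffs near x = ±1 -/

open scoped ContDiff in
/-- Smooth functions vanishing on `(-∞, 1)` and equal to `c` on `(2, ∞)`. -/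
def IsCutoff (S : ℝ → ℝ) (c : ℝ) : Prop :=
  ContDiff ℝ ∞ S ∧ (∀ y < 1, S y = 0) ∧ ∀ y > 2, S y = c

theorem isCutoff_smoothTransition : IsCutoff (fun y => Real.smoothTransition (y - 1)) 1 :=
  ⟨Real.smoothTransition.contDiff.comp (contDiff_id.sub contDiff_const),
    fun y hy => Real.smoothTransition.zero_of_nonpos (by linarith),
    fun y hy => Real.smoothTransition.one_of_one_le (by linarith)⟩

/-- Differentiating S((1 - x²)/δ) gives a factor 1/δ. One factor 1 - x² turns it into y S'(y) at y =
(1 - x²)/δ, again a cutoff, with limit 0; so the class is stable under the induction below. -/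
theorem IsCutoff.mul_deriv {S : ℝ → ℝ} {c : ℝ} (h : IsCutoff S c) :
    IsCutoff (fun y => y * deriv S y) 0 := by
  obtain ⟨h1, h2, h3⟩ := h
  refine ⟨contDiff_id.mul (contDiff_infty_iff_deriv.1 h1).2, fun y hy => ?_, fun y hy => ?_⟩
  · have : S =ᶠ[nhds y] fun _ => 0 := by
      filter_upwards [Iio_mem_nhds hy] with z hz using h2 z hz
    simp [this.deriv_eq]
  · have : S =ᶠ[nhds y] fun _ => c := by
      filter_upwards [Ioi_mem_nhds hy] with z hz using h3 z hz
    simp [this.deriv_eq]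

theorem IsCutoff.bounded {S : ℝ → ℝ} {c : ℝ} (h : IsCutoff S c) : ∃ M, ∀ y, |S y| ≤ M := by
  obtain ⟨h1, h2, h3⟩ := h
  obtain ⟨M, hM⟩ := isCompact_Icc.exists_bound_of_continuousOn (s := Icc (1 : ℝ) 2)
    h1.continuous.continuousOn
  refine ⟨max M |c|, fun y => ?_⟩
  rcases lt_or_ge y 1 with hy | hy
  · rw [h2 y hy, abs_zero]; positivity
  rcases le_or_gt y 2 with hy' | hy'
  · exact (hM y ⟨hy, hy'⟩).trans (le_max_left _ _)
  · rw [h3 y hy']; exact le_max_right _ _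

/-- The function `(1 - x²)ⁿ q(x) S((1 - x²) / δ)`. -/
def cutFun (n : ℕ) (q : Polynomial ℝ) (S : ℝ → ℝ) (δ x : ℝ) : ℝ :=
  (1 - x ^ 2) ^ n * q.eval x * S ((1 - x ^ 2) / δ)

open scoped ContDiff in
theorem contDiff_cutFun (n : ℕ) (q : Polynomial ℝ) {S : ℝ → ℝ} {c : ℝ} (h : IsCutoff S c) (δ : ℝ) :
    ContDiff ℝ ∞ (cutFun n q S δ) := by
  have := h.1
  have hq : ContDiff ℝ ∞ fun x => q.eval x := by
    simpa [Polynomial.coe_aeval_eq_eval] using q.contDiff_aeval (𝕜 := ℝ) ∞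
  unfold cutFun
  fun_prop

open Polynomial in
theorem deriv_cutFun (n : ℕ) (q : ℝ[X]) {S : ℝ → ℝ} {c : ℝ} (h : IsCutoff S c) (δ : ℝ) :
    deriv (cutFun (n + 1) q S δ) =
      cutFun n (C (-2 * ((n : ℝ) + 1)) * X * q + (1 - X ^ 2) * derivative q) S δ +
        cutFun n (C (-2) * X * q) (fun y => y * deriv S y) δ := by
  ext x
  have hw : HasDerivAt (fun x : ℝ => 1 - x ^ 2) (-(2 * x)) x := by
    simpa using (hasDerivAt_pow 2 x).const_sub 1
  have hS : HasDerivAt S (deriv S ((1 - x ^ 2) / δ)) ((1 - x ^ 2) / δ) :=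
    (h.1.differentiable (by simp) _).hasDerivAt
  have := ((hw.pow (n + 1)).mul (q.hasDerivAt x)).mul (hS.comp x (hw.div_const δ))
  refine (this.deriv).trans ?_
  simp [cutFun]
  ring

open Polynomial in
-- Each derivative spends one power of 1 - x² to absorb one 1/δ, so n derivatives stay bounded
-- uniformly in δ. Where 1 - x² > 2δ the cutoff equals c. These are the domination and the pointwise
-- limit for δ → 0.
theorem iteratedDeriv_cutFun (n : ℕ) : ∀ (q : ℝ[X]) {S : ℝ → ℝ} {c : ℝ}, IsCutoff S c →
    (∃ M, ∀ δ, ∀ x ∈ Ioo (-1 : ℝ) 1, |iteratedDeriv n (cutFun n q S δ) x| ≤ M) ∧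
    ∀ δ > 0, ∀ x, 2 * δ < 1 - x ^ 2 → iteratedDeriv n (cutFun n q S δ) x =
      c * (derivative^[n] ((1 - X ^ 2) ^ n * q)).eval x := by
  induction n with
  | zero =>
    intro q S c h
    obtain ⟨M, hM⟩ := h.bounded
    obtain ⟨C, hC⟩ := isCompact_Icc.exists_bound_of_continuousOn (s := Icc (-1 : ℝ) 1)
      q.continuous.continuousOn
    refine ⟨⟨C * M, fun δ x hx => ?_⟩, fun δ hδ x hx => ?_⟩
    · simp only [iteratedDeriv_zero, cutFun, pow_zero, one_mul, abs_mul]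
      exact mul_le_mul (hC x ⟨hx.1.le, hx.2.le⟩) (hM _) (abs_nonneg _)
        ((norm_nonneg _).trans (hC x ⟨hx.1.le, hx.2.le⟩))
    · have := h.2.2 ((1 - x ^ 2) / δ) (by rw [gt_iff_lt, lt_div_iff₀ hδ]; exact hx)
      simp [cutFun, this, mul_comm]
  | succ n ih =>
    intro q S c h
    obtain ⟨⟨M1, h1⟩, h1'⟩ := ih (C (-2 * ((n : ℝ) + 1)) * X * q + (1 - X ^ 2) * derivative q) h
    obtain ⟨⟨M2, h2⟩, h2'⟩ := ih (C (-2) * X * q) h.mul_deriv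
    have e : ∀ δ x, iteratedDeriv (n + 1) (cutFun (n + 1) q S δ) x =
        iteratedDeriv n (cutFun n (C (-2 * ((n : ℝ) + 1)) * X * q + (1 - X ^ 2) * derivative q)
          S δ) x + iteratedDeriv n (cutFun n (C (-2) * X * q) (fun y => y * deriv S y) δ) x := by
      intro δ x
      rw [iteratedDeriv_succ', deriv_cutFun n q h, iteratedDeriv_add]
      · exact (contDiff_cutFun n _ h δ).contDiffAt.of_le (by exact_mod_cast le_top)
      · exact (contDiff_cutFun n _ h.mul_deriv δ).contDiffAt.of_le (by exact_mod_cast le_top)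
    refine ⟨⟨M1 + M2, fun δ x hx => ?_⟩, fun δ hδ x hx => ?_⟩
    · rw [e]
      exact (abs_add_le _ _).trans (add_le_add (h1 δ x hx) (h2 δ x hx))
    · rw [e, h1' δ hδ x hx, h2' δ hδ x hx, zero_mul, add_zero, Function.iterate_succ_apply]
      congr 4
      rw [derivative_mul, derivative_pow]
      simp [C_ofNat]
      ring

open scoped ContDiff in
/-- The test function `(1 - x²)ⁿ q(x) S((1 - x²) / δ) v(t)`. -/
def cutTest (n : ℕ) (q : Polynomial ℝ) {S : ℝ → ℝ} {c : ℝ} (h : IsCutoff S c) {δ : ℝ} (hδ : 0 < δ)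
    {v : ℝ → ℝ} (hv : ContDiff ℝ ∞ v) (hc : HasCompactSupport v) : 𝓓(strip, ℝ) where
  toFun p := cutFun n q S δ p.1 * v p.2
  contDiff' := ((contDiff_cutFun n q h δ).comp contDiff_fst).mul (hv.comp contDiff_snd)
  hasCompactSupport' := by
    refine HasCompactSupport.intro (K := Icc (-1 : ℝ) 1 ×ˢ tsupport v)
      (isCompact_Icc.prod hc.isCompact) fun p hp => ?_
    by_contra hne
    refine hp ⟨?_, subset_tsupport _ (right_ne_zero_of_mul hne)⟩
    by_contra hx
    refine left_ne_zero_of_mul hne ?_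
    have : 1 - p.1 ^ 2 ≤ 0 := by
      by_contra! h0
      exact hx (abs_le.1 ((sq_le_one_iff_abs_le_one _).1 (by linarith)))
    rw [cutFun, h.2.1 _ ((div_nonpos_of_nonpos_of_nonneg this hδ.le).trans_lt one_pos), mul_zero]
  tsupport_subset' := by
    have h1 : tsupport (fun p : ℝ × ℝ => cutFun n q S δ p.1 * v p.2) ⊆ {p | δ ≤ 1 - p.1 ^ 2} := by
      refine closure_minimal (fun p hp => ?_) (isClosed_le (by fun_prop) (by fun_prop))
      by_contra hlt
      refine left_ne_zero_of_mul hp ?_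
      rw [cutFun, h.2.1 _ ((div_lt_one hδ).2 (not_le.1 hlt)), mul_zero]
    intro p hp
    have : δ ≤ 1 - p.1 ^ 2 := h1 hp
    exact ⟨abs_lt.1 ((sq_lt_one_iff_abs_lt_one _).1 (by linarith)), trivial⟩

/-! ### Weak derivatives tested against weighted polynomials -/

theorem weightedSq_eq (n : ℕ) (g : ℝ × ℝ → ℝ) :
    weightedSq n g = eLpNorm (fun p : ℝ × ℝ => g p * √(1 - p.1 ^ 2) ^ n) 2 μS ^ 2 := by
  have := eLpNorm_nnreal_pow_eq_lintegral (μ := μS) (p := 2)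
    (f := fun p : ℝ × ℝ => g p * √(1 - p.1 ^ 2) ^ n) two_ne_zero
  simp only [NNReal.coe_ofNat, ENNReal.coe_ofNat, ENNReal.rpow_ofNat] at this
  rw [this, weightedSq]
  refine lintegral_congr_ae ?_
  filter_upwards [ae_μS] with p hp
  rw [← ofReal_norm, ← ENNReal.ofReal_pow (norm_nonneg _), Real.norm_eq_abs, sq_abs,
    mul_pow, sq (√(1 - p.1 ^ 2) ^ n), sqrt_weight_sq hp]

theorem IsWeakDerivX.aestronglyMeasurable {n : ℕ} {f g : ℝ × ℝ → ℝ} (h : IsWeakDerivX n f g) :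
    AEStronglyMeasurable g μS :=
  h.2.1.aestronglyMeasurable

theorem IsWeakDerivX.aestronglyMeasurable_weight {n : ℕ} {f g : ℝ × ℝ → ℝ}
    (h : IsWeakDerivX n f g) :
    AEStronglyMeasurable (fun p : ℝ × ℝ => g p * √(1 - p.1 ^ 2) ^ n) μS :=
  h.aestronglyMeasurable.mul
    ((continuous_sqrt_weight n).comp continuous_fst).aestronglyMeasurable

theorem IsWeakDerivX.memLp_weight {n : ℕ} {f g : ℝ × ℝ → ℝ} (h : IsWeakDerivX n f g)
    (hw : weightedSq n g < ∞) : MemLp (fun p : ℝ × ℝ => g p * √(1 - p.1 ^ 2) ^ n) 2 μS := by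
  refine ⟨h.aestronglyMeasurable_weight, ?_⟩
  rw [weightedSq_eq] at hw
  exact lt_top_iff_ne_top.2 fun h => by simp [h] at hw

open scoped ContDiff in
theorem IsWeakDerivX.integral_cutTest {n : ℕ} {f g : ℝ × ℝ → ℝ} (h : IsWeakDerivX n f g)
    (q : Polynomial ℝ) {S : ℝ → ℝ} {c : ℝ} (hS : IsCutoff S c) {δ : ℝ} (hδ : 0 < δ)
    {v : ℝ → ℝ} (hv : ContDiff ℝ ∞ v) (hc : HasCompactSupport v) :
    ∫ p, f p * (iteratedDeriv n (cutFun n q S δ) p.1 * v p.2) ∂μS =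
      (-1) ^ n * ∫ p, g p * (cutFun n q S δ p.1 * v p.2) ∂μS := by
  refine Eq.trans ?_ (h.2.2 (cutTest n q hS hδ hv hc))
  congr 1
  ext p
  congr 1
  have : (fun y => cutTest n q hS hδ hv hc (y, p.2)) = fun y => v p.2 * cutFun n q S δ y := by
    ext y; exact mul_comm _ _
  rw [this, iteratedDeriv_const_mul_field, mul_comm]

open Polynomial in
open scoped ContDiff in
-- Dominated convergence on both sides of the cut-off identity, along δ = 1/(m + 1). At each point
-- the integrands are eventually equal to their limits.
theorem IsWeakDerivX.integral_weight_mul {n : ℕ} {f g : ℝ × ℝ → ℝ} (h : IsWeakDerivX n f g)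
    (hf : MemLp f 2 μS) (hG : MemLp (fun p : ℝ × ℝ => g p * √(1 - p.1 ^ 2) ^ n) 2 μS)
    (q : ℝ[X]) {v : ℝ → ℝ} (hv : ContDiff ℝ ∞ v) (hc : HasCompactSupport v) :
    ∫ p, f p * ((derivative^[n] ((1 - X ^ 2) ^ n * q)).eval p.1 * v p.2) ∂μS =
      (-1) ^ n * ∫ p, g p * √(1 - p.1 ^ 2) ^ n * (√(1 - p.1 ^ 2) ^ n * q.eval p.1) * v p.2 ∂μS := by
  have hS := isCutoff_smoothTransition
  set S : ℝ → ℝ := fun y => Real.smoothTransition (y - 1)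
  have hvL : MemLp v 2 volume := hv.continuous.memLp_of_hasCompactSupport hc
  obtain ⟨⟨M, hM⟩, hlim⟩ := iteratedDeriv_cutFun n q hS
  obtain ⟨M', hM'⟩ := hS.bounded
  have hδ : ∀ m : ℕ, (0 : ℝ) < 1 / ((m : ℝ) + 1) := fun m => by positivity
  have hev : ∀ p : ℝ × ℝ, p.1 ∈ Ioo (-1 : ℝ) 1 →
      ∀ᶠ m : ℕ in Filter.atTop, 2 * (1 / ((m : ℝ) + 1)) < 1 - p.1 ^ 2 := by
    intro p hp
    have h0 : 0 < (1 - p.1 ^ 2) / 2 := by nlinarith [hp.1, hp.2]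
    filter_upwards [(tendsto_one_div_add_atTop_nhds_zero_nat (𝕜 := ℝ)).eventually_lt_const h0]
      with m hm
    linarith
  have hcut : ∀ δ, Continuous fun p : ℝ × ℝ => cutFun n q S δ p.1 * v p.2 := fun δ =>
    ((contDiff_cutFun n q hS δ).continuous.comp continuous_fst).mul (hv.continuous.comp continuous_snd)
  have hcut' : ∀ δ, Continuous fun p : ℝ × ℝ => iteratedDeriv n (cutFun n q S δ) p.1 * v p.2 :=
    fun δ => ((contDiff_iteratedDeriv (contDiff_cutFun n q hS δ) n).continuous.comp
      continuous_fst).mul (hv.continuous.comp continuous_snd)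
  have t1 : Filter.Tendsto (fun m : ℕ => ∫ p, f p *
      (iteratedDeriv n (cutFun n q S (1 / ((m : ℝ) + 1))) p.1 * v p.2) ∂μS) Filter.atTop
      (nhds (∫ p, f p * ((derivative^[n] ((1 - X ^ 2) ^ n * q)).eval p.1 * v p.2) ∂μS)) := by
    refine tendsto_integral_of_dominated_convergence (fun p => M * ‖f p * v p.2‖)
      (fun m => hf.1.mul (hcut' _).aestronglyMeasurable)
      ((memLp_mul_snd_integrable hf hvL).norm.const_mul M) (fun m => ?_) ?_
    · filter_upwards [ae_μS] with p hp
      rw [norm_mul, norm_mul, norm_mul, mul_left_comm]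
      exact mul_le_mul_of_nonneg_right (hM _ _ hp) (by positivity)
    · filter_upwards [ae_μS] with p hp
      refine tendsto_nhds_of_eventually_eq ?_
      filter_upwards [hev p hp] with m hm
      rw [hlim _ (hδ m) _ hm, one_mul]
  have hGq : MemLp (fun p : ℝ × ℝ => g p * √(1 - p.1 ^ 2) ^ n *
      (√(1 - p.1 ^ 2) ^ n * q.eval p.1)) 2 μS :=
    memLp_mul_continuous hG ((continuous_sqrt_weight n).mul q.continuous)
  have t2 : Filter.Tendsto (fun m : ℕ => ∫ p, g p *
      (cutFun n q S (1 / ((m : ℝ) + 1)) p.1 * v p.2) ∂μS) Filter.atTop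
      (nhds (∫ p, g p * √(1 - p.1 ^ 2) ^ n * (√(1 - p.1 ^ 2) ^ n * q.eval p.1) * v p.2 ∂μS)) := by
    refine tendsto_integral_of_dominated_convergence
      (fun p => M' * ‖g p * √(1 - p.1 ^ 2) ^ n * (√(1 - p.1 ^ 2) ^ n * q.eval p.1) * v p.2‖)
      (fun m => h.aestronglyMeasurable.mul (hcut _).aestronglyMeasurable)
      ((memLp_mul_snd_integrable hGq hvL).norm.const_mul M') (fun m => ?_) ?_
    · filter_upwards [ae_μS] with p hp
      rw [cutFun, ← sqrt_weight_sq hp]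
      refine le_trans (le_of_eq ?_) (mul_le_mul_of_nonneg_right (hM' ((1 - p.1 ^ 2) /
        (1 / ((m : ℝ) + 1)))) (norm_nonneg _))
      rw [← Real.norm_eq_abs, ← norm_mul]
      congr 1
      ring
    · filter_upwards [ae_μS] with p hp
      refine tendsto_nhds_of_eventually_eq ?_
      filter_upwards [hev p hp] with m hm
      rw [cutFun, ← sqrt_weight_sq hp, hS.2.2 _ ((lt_div_iff₀ (hδ m)).2 hm)]
      ring
  have t3 := t2.const_mul ((-1) ^ n)
  refine tendsto_nhds_unique t1 (t3.congr fun m => ?_)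
  rw [h.integral_cutTest q hS (hδ m) hv hc]

open Polynomial in
-- The difference of the two sides is the pairing of v with a marginal in L²(ℝ). Smooth compactly
-- supported v annihilate it, so it vanishes almost everywhere, and then every v in L²(ℝ), in
-- particular ε_k, is allowed.
theorem IsWeakDerivX.integral_weight_mul_memLp {n : ℕ} {f g : ℝ × ℝ → ℝ} (h : IsWeakDerivX n f g)
    (hf : MemLp f 2 μS) (hG : MemLp (fun p : ℝ × ℝ => g p * √(1 - p.1 ^ 2) ^ n) 2 μS)
    (q : ℝ[X]) {v : ℝ → ℝ} (hv : MemLp v 2 volume) :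
    ∫ p, g p * √(1 - p.1 ^ 2) ^ n * (√(1 - p.1 ^ 2) ^ n * q.eval p.1) * v p.2 ∂μS =
      (-1) ^ n * ∫ p, f p * (derivative^[n] ((1 - X ^ 2) ^ n * q)).eval p.1 * v p.2 ∂μS := by
  have h1 : MemLp (fun p : ℝ × ℝ => g p * √(1 - p.1 ^ 2) ^ n *
      (√(1 - p.1 ^ 2) ^ n * q.eval p.1)) 2 μS :=
    memLp_mul_continuous hG ((continuous_sqrt_weight n).mul q.continuous)
  have h2 := (memLp_mul_continuous hf
    (derivative^[n] ((1 - X ^ 2) ^ n * q)).continuous).const_mul ((-1) ^ n)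
  have h3 := h1.sub h2
  have key : ∀ w : ℝ → ℝ, MemLp w 2 volume → ∫ p, (g p * √(1 - p.1 ^ 2) ^ n *
        (√(1 - p.1 ^ 2) ^ n * q.eval p.1) -
        (-1) ^ n * (f p * (derivative^[n] ((1 - X ^ 2) ^ n * q)).eval p.1)) * w p.2 ∂μS =
      ∫ p, g p * √(1 - p.1 ^ 2) ^ n * (√(1 - p.1 ^ 2) ^ n * q.eval p.1) * w p.2 ∂μS -
      (-1) ^ n * ∫ p, f p * (derivative^[n] ((1 - X ^ 2) ^ n * q)).eval p.1 * w p.2 ∂μS := by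
    intro w hw
    rw [← integral_const_mul, ← integral_sub (memLp_mul_snd_integrable h1 hw)]
    · congr 1; ext p; ring
    · simpa only [mul_assoc] using memLp_mul_snd_integrable h2 hw
  have hF := memLp_marginal h3
  have hz := ae_eq_zero_of_integral_contDiff_smul_eq_zero (hF.locallyIntegrable (by norm_num))
    fun w hw hwc => by
      have hwL : MemLp w 2 volume := hw.continuous.memLp_of_hasCompactSupport hwc
      have e := integral_mul_snd h3 hwL
      simp only [smul_eq_mul, mul_comm (w _)]
      refine e.symm.trans ((key w hwL).trans ?_)
      have e2 := h.integral_weight_mul hf hG q hw hwc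
      simp only [← mul_assoc] at e2 ⊢
      rw [e2, ← mul_assoc, ← mul_pow]
      simp
  rw [← sub_eq_zero, ← key v hv]
  refine (integral_mul_snd h3 hv).trans (integral_eq_zero_of_ae ?_)
  filter_upwards [hz] with t ht
  rw [ht, zero_mul]; rfl

/-! ### Orthogonal families with arbitrary, possibly zero, lengths -/

section Orthogonal

variable {H ι : Type*} [NormedAddCommGroup H] [InnerProductSpace ℝ H] [DecidableEq ι]
  {e : ι → H} {l b : ι → ℝ}

theorem norm_sum_sq_of_orthogonal (he : ∀ i j, inner ℝ (e i) (e j) = if i = j then l j else 0)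
    (s : Finset ι) : ‖∑ i ∈ s, b i • e i‖ ^ 2 = ∑ i ∈ s, l i * b i ^ 2 := by
  rw [← real_inner_self_eq_norm_sq, sum_inner]
  refine Finset.sum_congr rfl fun i hi => ?_
  rw [inner_sum, Finset.sum_eq_single i]
  · rw [real_inner_smul_left, real_inner_smul_right, he, if_pos rfl]; ring
  · intro j _ hj
    rw [real_inner_smul_left, real_inner_smul_right, he, if_neg hj.symm]; ring
  · exact fun h => absurd hi h

/-- Bessel's inequality, by expanding ‖G - ∑ b_i e_i‖² ≥ 0. No division by l_i occurs, so vanishing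
e_i do no harm. -/
theorem sum_le_norm_sq_of_orthogonal
    (he : ∀ i j, inner ℝ (e i) (e j) = if i = j then l j else 0) {G : H}
    (hG : ∀ i, inner ℝ (e i) G = l i * b i) (s : Finset ι) :
    ∑ i ∈ s, l i * b i ^ 2 ≤ ‖G‖ ^ 2 := by
  have h1 := norm_sub_sq_real G (∑ i ∈ s, b i • e i)
  have h2 : inner ℝ G (∑ i ∈ s, b i • e i) = ∑ i ∈ s, l i * b i ^ 2 := by
    rw [inner_sum]
    refine Finset.sum_congr rfl fun i _ => ?_
    rw [real_inner_smul_right, real_inner_comm, hG]; ring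
  rw [norm_sum_sq_of_orthogonal he, h2] at h1
  nlinarith [sq_nonneg ‖G - ∑ i ∈ s, b i • e i‖]

theorem summable_of_orthogonal [CompleteSpace H]
    (he : ∀ i j, inner ℝ (e i) (e j) = if i = j then l j else 0)
    (hs : Summable fun i => l i * b i ^ 2) : Summable fun i => b i • e i := by
  rw [summable_iff_vanishing_norm] at hs ⊢
  intro δ hδ
  obtain ⟨s, hs⟩ := hs (δ ^ 2) (by positivity)
  refine ⟨s, fun t ht => ?_⟩
  refine lt_of_pow_lt_pow_left₀ 2 hδ.le ?_
  rw [norm_sum_sq_of_orthogonal he]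
  exact (le_abs_self _).trans_lt (hs t ht)

theorem norm_tsum_sq_of_orthogonal [CompleteSpace H]
    (he : ∀ i j, inner ℝ (e i) (e j) = if i = j then l j else 0)
    (hs : Summable fun i => l i * b i ^ 2) :
    ‖∑' i, b i • e i‖ ^ 2 = ∑' i, l i * b i ^ 2 := by
  have h1 := ((summable_of_orthogonal he hs).hasSum.norm).pow 2
  simp only [norm_sum_sq_of_orthogonal he] at h1
  exact tendsto_nhds_unique h1 hs.hasSum

end Orthogonal

/-! ### The weighted seminorms as sums over coefficients -/

section Basis

variable (ε : HilbertBasis ℕ ℝ (Lp ℝ 2 (volume : Measure ℝ)))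

theorem IsWeakDerivX.inner_eLp_weight {n : ℕ} {f g : ℝ × ℝ → ℝ} (h : IsWeakDerivX n f g)
    (hf : MemLp f 2 μS) (hG : MemLp (fun p : ℝ × ℝ => g p * √(1 - p.1 ^ 2) ^ n) 2 μS)
    (q : ℕ × ℕ) :
    inner ℝ (eLp ε n q) (hG.toLp _) = lam n q.2 * coeff ε f q.1 q.2 := by
  have e := h.integral_weight_mul_memLp hf hG (Polynomial.derivative^[n] (nleg q.2))
    (Lp.memLp (ε q.1))
  rw [iterate_derivative_weight_mul_nleg] at e
  rw [eLp, inner_toLp]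
  calc ∫ p, eFun ε n q p * (g p * √(1 - p.1 ^ 2) ^ n) ∂μS
      = ∫ p, g p * √(1 - p.1 ^ 2) ^ n * (√(1 - p.1 ^ 2) ^ n *
          (Polynomial.derivative^[n] (nleg q.2)).eval p.1) * (ε q.1 : ℝ → ℝ) p.2 ∂μS := by
        congr 1; ext p; simp only [eFun, legFun]; ring
    _ = (-1) ^ n * ∫ p, ((-1) ^ n * lam n q.2) *
          (f p * (ε q.1 : ℝ → ℝ) p.2 * normLegendre q.2 p.1) ∂μS := by
        rw [e]; congr 2; ext p
        rw [Polynomial.eval_mul, Polynomial.eval_C, eval_nleg]; ring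
    _ = lam n q.2 * coeff ε f q.1 q.2 := by
        rw [integral_const_mul, coeff, ← mul_assoc, ← mul_assoc, ← mul_pow]; simp

theorem IsWeakDerivX.tsum_le {n : ℕ} {f g : ℝ × ℝ → ℝ} (h : IsWeakDerivX n f g)
    (hf : MemLp f 2 μS) :
    ∑' q : ℕ × ℕ, ENNReal.ofReal (lam n q.2 * coeff ε f q.1 q.2 ^ 2) ≤ weightedSq n g := by
  rcases eq_or_ne (weightedSq n g) ∞ with hw | hw
  · rw [hw]; exact le_top
  have hG := h.memLp_weight (lt_top_iff_ne_top.2 hw)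
  rw [weightedSq_eq, eLpNorm_sq hG, ← norm_toLp_sq hG, ENNReal.tsum_eq_iSup_sum]
  refine iSup_le fun s => ?_
  rw [← ENNReal.ofReal_sum_of_nonneg fun q _ => mul_nonneg (lam_nonneg _ _) (sq_nonneg _)]
  exact ENNReal.ofReal_le_ofReal (sum_le_norm_sq_of_orthogonal (e := eLp ε n)
    (l := fun q => lam n q.2) (inner_eLp ε n) (h.inner_eLp_weight ε hf hG) s)

/-- The weak derivative identity for the smooth function P_j ε_k in the variable x, with (1 -
x²)^{n/2} inserted in one factor and divided out of the other. -/
theorem inner_eLp_testFunction (n : ℕ) (q : ℕ × ℕ) (φ : 𝓓(strip, ℝ))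
    (hψ : MemLp (fun p : ℝ × ℝ => φ p * (√(1 - p.1 ^ 2) ^ n)⁻¹) 2 μS) :
    inner ℝ (eLp ε n q) (hψ.toLp _) =
      (-1) ^ n * inner ℝ (eLp ε 0 q) ((memLp_testFunction_deriv φ n).toLp _) := by
  rw [eLp, eLp, inner_toLp, inner_toLp]
  have hw := (isWeakDerivX_tensor (isWeakDeriv_poly (nleg q.2) n)
    (memLp_of_continuous (Polynomial.continuous _)) (memLp_of_continuous (Polynomial.continuous _))
    (Lp.memLp (ε q.1))).2.2 φ
  have e : ∀ p, eFun ε 0 q p = (nleg q.2).eval p.1 * (ε q.1 : ℝ → ℝ) p.2 := fun p => by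
    simp [eFun, legFun]
  simp only [e]
  rw [hw, ← mul_assoc, ← mul_pow]
  simp only [mul_neg, mul_one, neg_neg, one_pow, one_mul]
  refine integral_congr_ae ?_
  filter_upwards [ae_μS] with p hp
  have : √(1 - p.1 ^ 2) ≠ 0 := (Real.sqrt_pos.2 (by nlinarith [hp.1, hp.2])).ne'
  simp only [eFun, legFun]
  field_simp

theorem memLp_testFunction_div (φ : 𝓓(strip, ℝ)) (n : ℕ) :
    MemLp (fun p : ℝ × ℝ => φ p * (√(1 - p.1 ^ 2) ^ n)⁻¹) 2 μS := by
  have hc : ContinuousOn (fun p : ℝ × ℝ => (√(1 - p.1 ^ 2) ^ n)⁻¹) (tsupport φ) := by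
    refine ContinuousOn.inv₀ (by fun_prop) fun p hp => ?_
    have h1 : p.1 ∈ Ioo (-1 : ℝ) 1 := (φ.tsupport_subset hp).1
    exact pow_ne_zero _ (Real.sqrt_pos.2 (by nlinarith [h1.1, h1.2])).ne'
  obtain ⟨C, hC⟩ := φ.hasCompactSupport.isCompact.exists_bound_of_continuousOn hc
  refine MemLp.of_le_mul (c := C) (memLp_testFunction φ)
    ((memLp_testFunction φ).1.mul ?_) (Filter.Eventually.of_forall fun p => ?_)
  · exact (Measurable.inv (by fun_prop)).aestronglyMeasurable
  · rw [norm_mul, mul_comm]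
    by_cases hp : p ∈ tsupport φ
    · exact mul_le_mul_of_nonneg_right (hC p hp) (norm_nonneg _)
    · rw [image_eq_zero_of_notMem_tsupport hp]; simp

theorem exists_isWeakDerivX {n : ℕ} {f : ℝ × ℝ → ℝ} (hf : MemLp f 2 μS)
    (hs : ∑' q : ℕ × ℕ, ENNReal.ofReal (lam n q.2 * coeff ε f q.1 q.2 ^ 2) ≠ ∞) :
    ∃ g, IsWeakDerivX n f g ∧
      weightedSq n g = ∑' q : ℕ × ℕ, ENNReal.ofReal (lam n q.2 * coeff ε f q.1 q.2 ^ 2) := by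
  have hnn : ∀ q : ℕ × ℕ, 0 ≤ lam n q.2 * coeff ε f q.1 q.2 ^ 2 := fun q =>
    mul_nonneg (lam_nonneg _ _) (sq_nonneg _)
  have hsum : Summable fun q : ℕ × ℕ => lam n q.2 * coeff ε f q.1 q.2 ^ 2 := by
    have := ENNReal.summable_toReal hs
    simpa only [ENNReal.toReal_ofReal (hnn _)] using this
  have hS := summable_of_orthogonal (e := eLp ε n) (l := fun q => lam n q.2)
    (b := fun q => coeff ε f q.1 q.2) (inner_eLp ε n) hsum
  have hN := norm_tsum_sq_of_orthogonal (e := eLp ε n) (l := fun q => lam n q.2)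
    (b := fun q => coeff ε f q.1 q.2) (inner_eLp ε n) hsum
  set G : Lp ℝ 2 μS := ∑' q : ℕ × ℕ, coeff ε f q.1 q.2 • eLp ε n q with hGdef
  have hG := Lp.memLp G
  have hpos : ∀ p : ℝ × ℝ, p.1 ∈ Ioo (-1 : ℝ) 1 → √(1 - p.1 ^ 2) ^ n ≠ 0 := fun p hp =>
    pow_ne_zero _ (Real.sqrt_pos.2 (by nlinarith [hp.1, hp.2])).ne'
  -- The candidate is the L² sum G with the weight divided out. It need not be in L², but the weight
  -- is continuous and nonzero inside the strip, so it is locally integrable.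
  refine ⟨fun p => G p * (√(1 - p.1 ^ 2) ^ n)⁻¹, ⟨locallyIntegrableOn_of_memLp hf, ?_, fun φ => ?_⟩,
    ?_⟩
  · refine (locallyIntegrableOn_of_memLp hG).mul_continuousOn ?_ strip.isOpen.isLocallyClosed
    exact ContinuousOn.inv₀ (by fun_prop) fun p hp => hpos p hp.1
  · have hψ := memLp_testFunction_div φ n
    have h1 : HasSum (fun q : ℕ × ℕ => coeff ε f q.1 q.2 * inner ℝ (eLp ε n q) (hψ.toLp _))
        (inner ℝ G (hψ.toLp _)) := by
      have := hS.hasSum.mapL (innerSL ℝ (hψ.toLp _))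
      simpa [real_inner_comm, real_inner_smul_right] using this
    have h2 := (hasSum_coeff_mul_inner ε hf
      ((memLp_testFunction_deriv φ n).toLp _)).mul_left ((-1) ^ n)
    -- The expansions of ⟨G, φ/weight⟩ and of (-1)ⁿ⟨f, ∂ⁿφ⟩ agree term by term.
    have h3 := h1.unique (h2.congr_fun fun q => by
      rw [inner_eLp_testFunction]; ring)
    rw [← Lp.toLp_coeFn G hG, inner_toLp, inner_toLp] at h3
    have e : ∫ p, G p * (√(1 - p.1 ^ 2) ^ n)⁻¹ * φ p ∂μS =
        ∫ p, G p * (φ p * (√(1 - p.1 ^ 2) ^ n)⁻¹) ∂μS := by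
      congr 1; ext p; ring
    rw [e, h3, ← mul_assoc, ← mul_pow]
    simp
  · rw [weightedSq_eq, eLpNorm_congr_ae (g := G), eLpNorm_sq hG, ← norm_toLp_sq hG,
      Lp.toLp_coeFn, hN, ENNReal.ofReal_tsum_of_nonneg hnn hsum]
    filter_upwards [ae_μS] with p hp
    rw [inv_mul_cancel_right₀ (hpos p hp)]

/-- Bessel bounds every weak derivative from below; a finite sum is attained by the derivative built
from the series. -/
theorem seminormSq_eq (n : ℕ) {f : ℝ × ℝ → ℝ} (hf : MemLp f 2 μS) :
    seminormSq n f = ∑' q : ℕ × ℕ, ENNReal.ofReal (lam n q.2 * coeff ε f q.1 q.2 ^ 2) := by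
  refine le_antisymm ?_ (le_iInf₂ fun g hg => hg.tsum_le ε hf)
  rcases eq_or_ne (∑' q : ℕ × ℕ, ENNReal.ofReal (lam n q.2 * coeff ε f q.1 q.2 ^ 2)) ∞ with h | h
  · rw [h]; exact le_top
  · obtain ⟨g, hg, he⟩ := exists_isWeakDerivX ε hf h
    rw [← he]
    exact iInf₂_le g hg

end Basis

/-! ### Comparison of the eigenvalue products with powers of 1 + j -/

theorem lam_le (n j : ℕ) : lam n j ≤ (1 + (j : ℝ)) ^ (2 * n) := by
  rcases lt_or_ge j n with h | h
  · rw [lam_eq_zero h]; positivity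
  · rw [pow_mul, lam, ← Finset.card_range n, ← Finset.prod_const, Finset.card_range]
    refine Finset.prod_le_prod (fun i hi => ?_) fun i _ => ?_
    · have hi' : (i : ℝ) ≤ j := by exact_mod_cast (Finset.mem_range.1 hi).le.trans h
      have : (0 : ℝ) ≤ i := by positivity
      nlinarith
    · have : (0 : ℝ) ≤ i := by positivity
      have : (0 : ℝ) ≤ j := by positivity
      nlinarith

/-- Factor by factor: j(j+1) - i(i+1) = (j - i)(j + i + 1), and i < n ≤ j gives j + 1 ≤ (n + 1)(j -
i). -/
theorem le_lam {n j : ℕ} (h : n ≤ j) :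
    (1 + (j : ℝ)) ^ (2 * n) ≤ ((n : ℝ) + 1) ^ n * lam n j := by
  have : ∏ _i ∈ Finset.range n, (1 + (j : ℝ)) ^ 2 ≤
      ∏ i ∈ Finset.range n, (((n : ℝ) + 1) * ((j : ℝ) * (j + 1) - i * (i + 1))) := by
    refine Finset.prod_le_prod (fun i _ => by positivity) fun i hi => ?_
    have hi' : (i : ℝ) + 1 ≤ n := by exact_mod_cast Finset.mem_range.1 hi
    have hj : (n : ℝ) ≤ j := by exact_mod_cast h
    have hi0 : (0 : ℝ) ≤ i := by positivity
    have h1 : (j : ℝ) + 1 ≤ (n + 1) * (j - i) := by nlinarith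
    have h2 : (j : ℝ) + 1 ≤ j + i + 1 := by linarith
    have h3 : (0 : ℝ) ≤ j + 1 := by positivity
    nlinarith [mul_le_mul h1 h2 h3 (h3.trans h1)]
  rwa [Finset.prod_mul_distrib, Finset.prod_const, Finset.prod_const, Finset.card_range,
    ← pow_mul] at this

/-- The added 1, which stands for the L² norm, covers the indices j < n where `lam n j` vanishes. -/
theorem le_one_add_lam (n j : ℕ) :
    (1 + (j : ℝ)) ^ (2 * n) ≤ ((n : ℝ) + 1) ^ (2 * n) * (1 + lam n j) := by
  have h1 : (1 : ℝ) ≤ (n : ℝ) + 1 := by simp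
  have hl := lam_nonneg n j
  rcases lt_or_ge j n with h | h
  · rw [lam_eq_zero h, add_zero, mul_one]
    have : (j : ℝ) ≤ n := by exact_mod_cast h.le
    exact pow_le_pow_left₀ (by positivity) (by linarith) _
  · refine (le_lam h).trans ?_
    have : ((n : ℝ) + 1) ^ n ≤ ((n : ℝ) + 1) ^ (2 * n) := pow_le_pow_right₀ h1 (by lia)
    nlinarith [pow_pos (zero_lt_one.trans_le h1) (2 * n)]

/-- The squared norm of order `n` of `P_j`. -/
def lamSum (n j : ℕ) : ℝ := ∑ i ∈ Finset.range (n + 1), lam i j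

theorem lamSum_nonneg (n j : ℕ) : 0 ≤ lamSum n j := Finset.sum_nonneg fun i _ => lam_nonneg i j

theorem lamSum_le (n j : ℕ) : lamSum n j ≤ ((n : ℝ) + 1) * (1 + (j : ℝ)) ^ (2 * n) := by
  have : lamSum n j ≤ ∑ _i ∈ Finset.range (n + 1), (1 + (j : ℝ)) ^ (2 * n) := by
    refine Finset.sum_le_sum fun i hi => (lam_le i j).trans ?_
    exact pow_le_pow_right₀ (by simp) (by have := Finset.mem_range.1 hi; lia)
  simpa using this

theorem le_lamSum (n j : ℕ) :
    (1 + (j : ℝ)) ^ (2 * n) ≤ (2 * ((n : ℝ) + 1) ^ (2 * n)) * lamSum n j := by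
  refine (le_one_add_lam n j).trans ?_
  have h1 : 1 ≤ lamSum n j := by
    have : lam 0 j ≤ lamSum n j :=
      Finset.single_le_sum (f := fun i => lam i j) (fun i _ => lam_nonneg i j)
        (Finset.mem_range.2 n.succ_pos)
    rwa [lam_zero] at this
  have h2 : lam n j ≤ lamSum n j :=
    Finset.single_le_sum (f := fun i => lam i j) (fun i _ => lam_nonneg i j)
      (Finset.mem_range.2 n.lt_succ_self)
  have : (0 : ℝ) < ((n : ℝ) + 1) ^ (2 * n) := by positivity
  nlinarith

/-! ### Integer orders as weighted ℓ² spaces -/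

section Basis

variable (ε : HilbertBasis ℕ ℝ (Lp ℝ 2 (volume : Measure ℝ)))

theorem coeff_congr {f g : ℝ × ℝ → ℝ} (h : f =ᵐ[μS] g) (k j : ℕ) :
    coeff ε f k j = coeff ε g k j := by
  refine integral_congr_ae ?_
  filter_upwards [h] with p hp
  rw [hp]

theorem coeff_add {f g : ℝ × ℝ → ℝ} (hf : MemLp f 2 μS) (hg : MemLp g 2 μS) (q : ℕ × ℕ) :
    coeff ε (f + g) q.1 q.2 = coeff ε f q.1 q.2 + coeff ε g q.1 q.2 := by
  rw [coeff_eq_inner ε hf, coeff_eq_inner ε hg, coeff_eq_inner ε (hf.add hg), MemLp.toLp_add,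
    inner_add_right]

theorem coeff_smul (a : ℝ) (f : ℝ × ℝ → ℝ) (q : ℕ × ℕ) :
    coeff ε (a • f) q.1 q.2 = a * coeff ε f q.1 q.2 := by
  simp only [coeff, Pi.smul_apply, smul_eq_mul, mul_assoc]
  rw [integral_const_mul]

theorem coeff_sub {f g : ℝ × ℝ → ℝ} (hf : MemLp f 2 μS) (hg : MemLp g 2 μS) (q : ℕ × ℕ) :
    coeff ε (f - g) q.1 q.2 = coeff ε f q.1 q.2 - coeff ε g q.1 q.2 := by
  rw [coeff_eq_inner ε hf, coeff_eq_inner ε hg, coeff_eq_inner ε (hf.sub hg), MemLp.toLp_sub,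
    inner_sub_right]

theorem coeff_eFun (q r : ℕ × ℕ) : coeff ε (eFun ε 0 r) q.1 q.2 = if q = r then 1 else 0 := by
  rw [coeff_eq_inner ε (memLp_eFun ε 0 r), ← eLp, inner_eLp, lam_zero]

/-- The weighted sum `∑ ω_j b_{k,j}²`. -/
def wSum (ω : ℕ → ℝ) (f : ℝ × ℝ → ℝ) : ℝ≥0∞ :=
  ∑' q : ℕ × ℕ, ENNReal.ofReal (ω q.2 * coeff ε f q.1 q.2 ^ 2)

theorem wSum_le {ω ω' : ℕ → ℝ} {c : ℝ} (hc : 0 ≤ c) (h : ∀ j, ω j ≤ c * ω' j)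
    (f : ℝ × ℝ → ℝ) : wSum ε ω f ≤ ENNReal.ofReal c * wSum ε ω' f := by
  rw [wSum, wSum, ← ENNReal.tsum_mul_left]
  refine ENNReal.tsum_le_tsum fun q => ?_
  rw [← ENNReal.ofReal_mul hc, ← mul_assoc]
  exact ENNReal.ofReal_le_ofReal (mul_le_mul_of_nonneg_right (h _) (sq_nonneg _))

theorem wSum_add {ω ω' : ℕ → ℝ} (h : ∀ j, 0 ≤ ω j) (h' : ∀ j, 0 ≤ ω' j) (f : ℝ × ℝ → ℝ) :
    wSum ε (fun j => ω j + ω' j) f = wSum ε ω f + wSum ε ω' f := by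
  rw [wSum, wSum, wSum, ← ENNReal.tsum_add]
  congr 1
  ext q
  rw [add_mul, ENNReal.ofReal_add (mul_nonneg (h _) (sq_nonneg _)) (mul_nonneg (h' _) (sq_nonneg _))]

theorem wSum_one {f : ℝ × ℝ → ℝ} (hf : MemLp f 2 μS) :
    wSum ε (fun _ => 1) f = eLpNorm f 2 μS ^ 2 := by
  rw [← tsum_coeff_sq ε hf, wSum]
  simp only [one_mul]

theorem wSum_le_add {ω : ℕ → ℝ} (h : ∀ j, 0 ≤ ω j) {f g h' : ℝ × ℝ → ℝ}
    (hc : ∀ q : ℕ × ℕ, coeff ε f q.1 q.2 = coeff ε g q.1 q.2 + coeff ε h' q.1 q.2) :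
    wSum ε ω f ≤ 2 * (wSum ε ω g + wSum ε ω h') := by
  rw [wSum, wSum, wSum, ← ENNReal.tsum_add, ← ENNReal.tsum_mul_left]
  refine ENNReal.tsum_le_tsum fun q => ?_
  have h1 := mul_nonneg (h q.2) (sq_nonneg (coeff ε g q.1 q.2))
  have h2 := mul_nonneg (h q.2) (sq_nonneg (coeff ε h' q.1 q.2))
  rw [← ENNReal.ofReal_add h1 h2, ← ENNReal.ofReal_ofNat 2, ← ENNReal.ofReal_mul zero_le_two, hc]
  refine ENNReal.ofReal_le_ofReal ?_
  nlinarith [mul_nonneg (h q.2) (sq_nonneg (coeff ε g q.1 q.2 - coeff ε h' q.1 q.2))]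

theorem normInt_sq (n : ℕ) {f : ℝ × ℝ → ℝ} (hf : MemLp f 2 μS) :
    normInt n f ^ 2 = wSum ε (lamSum n) f := by
  rw [normInt, ← ENNReal.rpow_natCast, ← ENNReal.rpow_mul]
  norm_num
  simp only [seminormSq_eq ε _ hf]
  rw [← Summable.tsum_finsetSum fun _ _ => ENNReal.summable, wSum]
  congr 1
  ext q
  rw [lamSum, Finset.sum_mul, ENNReal.ofReal_sum_of_nonneg fun i _ =>
    mul_nonneg (lam_nonneg i _) (sq_nonneg _)]

theorem normInt_tensor_lt_top {n : ℕ} {u v : ℝ → ℝ} (hu : MemH n u) (hv : MemLp v 2 volume) :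
    normInt n (fun p => u p.1 * v p.2) < ∞ := by
  refine ENNReal.rpow_lt_top_of_nonneg (by norm_num) (ENNReal.sum_lt_top.2 fun i hi => ?_).ne
  obtain ⟨g, hg, hgL⟩ := hu.2 i (by have := Finset.mem_range.1 hi; lia)
  refine (iInf₂_le _ (isWeakDerivX_tensor hg hu.1 hgL hv)).trans_lt ?_
  rw [weightedSq_eq]
  exact ENNReal.pow_lt_top
    (memLp_mul_continuous (memLp_tensor hgL hv) (continuous_sqrt_weight i)).2

theorem wSum_lt_top_of_mem_tensorHL {n : ℕ} {g : ℝ × ℝ → ℝ} (hg : g ∈ tensorHL n) :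
    MemLp g 2 μS ∧ wSum ε (lamSum n) g < ∞ := by
  induction hg using Submodule.span_induction with
  | mem g hg =>
    obtain ⟨u, v, hu, hv, rfl⟩ := hg
    have hm := memLp_tensor hu.1 hv
    exact ⟨hm, by rw [← normInt_sq ε n hm]; exact ENNReal.pow_lt_top (normInt_tensor_lt_top hu hv)⟩
  | zero => exact ⟨MemLp.zero, by simp [wSum, coeff]⟩
  | add f g _ _ hf hg =>
    refine ⟨hf.1.add hg.1, (wSum_le_add ε (lamSum_nonneg n) (coeff_add ε hf.1 hg.1)).trans_lt ?_⟩
    exact ENNReal.mul_lt_top (by simp) (ENNReal.add_lt_top.2 ⟨hf.2, hg.2⟩)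
  | smul a f _ hf =>
    refine ⟨hf.1.const_smul a, ?_⟩
    have : wSum ε (lamSum n) (a • f) = ENNReal.ofReal (a ^ 2) * wSum ε (lamSum n) f := by
      rw [wSum, wSum, ← ENNReal.tsum_mul_left]
      congr 1
      ext q
      rw [coeff_smul, ← ENNReal.ofReal_mul (sq_nonneg a)]
      congr 1
      ring
    rw [this]
    exact ENNReal.mul_lt_top ENNReal.ofReal_lt_top hf.2

theorem eFun_mem_tensorHL (n : ℕ) (q : ℕ × ℕ) : eFun ε 0 q ∈ tensorHL n := by
  refine Submodule.subset_span ⟨fun x => (nleg q.2).eval x, (ε q.1 : ℝ → ℝ), memH_poly _ _,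
    Lp.memLp _, ?_⟩
  ext p
  simp [eFun, legFun]

theorem exists_truncation (n : ℕ) (b : ℕ × ℕ → ℝ) (s : Finset (ℕ × ℕ)) :
    ∃ g ∈ tensorHL n, ∀ q : ℕ × ℕ, coeff ε g q.1 q.2 = if q ∈ s then b q else 0 := by
  induction s using Finset.induction_on with
  | empty => exact ⟨0, zero_mem _, fun q => by simp [coeff]⟩
  | insert r s hr ih =>
    obtain ⟨g, hg, hc⟩ := ih
    have he := Submodule.smul_mem _ (b r) (eFun_mem_tensorHL ε n r)
    refine ⟨b r • eFun ε 0 r + g, add_mem he hg, fun q => ?_⟩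
    rw [coeff_add ε (wSum_lt_top_of_mem_tensorHL ε he).1 (wSum_lt_top_of_mem_tensorHL ε hg).1,
      coeff_smul, coeff_eFun, hc]
    by_cases h : q = r
    · subst h; simp [hr]
    · simp [h]

/-- Elements of the tensor product have finite norm since the weights are at most 1, and finiteness
passes to the closure. Conversely, finite truncations of the expansion are polynomials in x times
ε_k, and their error is the tail of a convergent series. -/
theorem memVInt_iff (n : ℕ) (f : ℝ × ℝ → ℝ) :
    MemVInt n f ↔ MemLp f 2 μS ∧ wSum ε (lamSum n) f < ∞ := by
  refine and_congr_right fun hf => ⟨fun h => ?_, fun h δ hδ => ?_⟩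
  -- One approximant at finite distance is enough.
  · obtain ⟨g, hg, hlt⟩ := h 1 one_pos
    obtain ⟨hgL, hgt⟩ := wSum_lt_top_of_mem_tensorHL ε hg
    have h1 : wSum ε (lamSum n) (f - g) < ∞ := by
      rw [← normInt_sq ε n (hf.sub hgL)]
      exact ENNReal.pow_lt_top (hlt.trans ENNReal.one_lt_top)
    refine (wSum_le_add ε (lamSum_nonneg n) (g := f - g) (h' := g) fun q => ?_).trans_lt
      (ENNReal.mul_lt_top (by simp) (ENNReal.add_lt_top.2 ⟨h1, hgt⟩))
    rw [coeff_sub ε hf hgL]; ring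
  · have ht := ENNReal.tendsto_tsum_compl_atTop_zero h.ne
    obtain ⟨s, hs⟩ := (ht.eventually_lt_const (pos_iff_ne_zero.2 (pow_ne_zero 2 hδ.ne'))).exists
    obtain ⟨g, hg, hc⟩ := exists_truncation ε n (fun q => coeff ε f q.1 q.2) s
    have hgL := (wSum_lt_top_of_mem_tensorHL ε hg).1
    refine ⟨g, hg, lt_of_pow_lt_pow_left' 2 ?_⟩
    rw [normInt_sq ε n (hf.sub hgL)]
    refine lt_of_eq_of_lt ?_ hs
    refine Eq.trans ?_ (tsum_subtype {q | q ∉ s}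
      fun q : ℕ × ℕ => ENNReal.ofReal (lamSum n q.2 * coeff ε f q.1 q.2 ^ 2)).symm
    rw [wSum]
    congr 1
    ext q
    rw [coeff_sub ε hf hgL, hc]
    by_cases hq : q ∈ s <;> simp [hq]

/-- The part of `f` with indices in `A`. -/
theorem exists_coeff_indicator {f : ℝ × ℝ → ℝ} (hf : MemLp f 2 μS) (A : Set (ℕ × ℕ)) :
    ∃ h, MemLp h 2 μS ∧
      ∀ q : ℕ × ℕ, coeff ε h q.1 q.2 = A.indicator (fun q => coeff ε f q.1 q.2) q := by
  have hl : Memℓp (A.indicator fun q : ℕ × ℕ => coeff ε f q.1 q.2) 2 := by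
    have h1 : Memℓp (fun q : ℕ × ℕ => coeff ε f q.1 q.2) 2 := by
      have e : (fun q : ℕ × ℕ => coeff ε f q.1 q.2) = (stripBasis ε).repr (hf.toLp f) := by
        ext q
        rw [HilbertBasis.repr_apply_apply, coe_stripBasis, coeff_eq_inner ε hf]
      rw [e]
      exact lp.memℓp _
    refine h1.mono' fun q => ?_
    by_cases hq : q ∈ A <;> simp [hq]
  set G : Lp ℝ 2 μS := (stripBasis ε).repr.symm ⟨_, hl⟩ with hG
  refine ⟨G, Lp.memLp G, fun q => ?_⟩
  rw [coeff_eq_inner ε (Lp.memLp G), Lp.toLp_coeFn, ← coe_stripBasis, ← HilbertBasis.repr_apply_apply,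
    hG, LinearIsometryEquiv.apply_symm_apply]

end Basis

/-! ### Real interpolation between consecutive integer orders -/

/-- The weight `(1 + j)^{2n} min(1, r² (1 + j)²)`. -/
def kWeight (n : ℕ) (r : ℝ) (j : ℕ) : ℝ :=
  (1 + (j : ℝ)) ^ (2 * n) * min 1 ((r * (1 + (j : ℝ))) ^ 2)

theorem kWeight_nonneg (n : ℕ) (r : ℝ) (j : ℕ) : 0 ≤ kWeight n r j :=
  mul_nonneg (by positivity) (le_min zero_le_one (sq_nonneg _))

theorem kWeight_le_left (n : ℕ) (r : ℝ) (j : ℕ) : kWeight n r j ≤ (1 + (j : ℝ)) ^ (2 * n) :=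
  mul_le_of_le_one_right (by positivity) (min_le_left _ _)

theorem kWeight_le_right (n : ℕ) (r : ℝ) (j : ℕ) :
    kWeight n r j ≤ r ^ 2 * (1 + (j : ℝ)) ^ (2 * (n + 1)) := by
  refine (mul_le_mul_of_nonneg_left (min_le_right _ _) (by positivity)).trans_eq ?_
  ring

section Basis

variable (ε : HilbertBasis ℕ ℝ (Lp ℝ 2 (volume : Measure ℝ)))

theorem wSum_kWeight_le_decomposition (n : ℕ) {r : ℝ} (hr : 0 < r) {f v w : ℝ × ℝ → ℝ}
    (hv : MemLp v 2 μS) (hw : MemLp w 2 μS) (hf : f =ᵐ[μS] v + w) :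
    wSum ε (kWeight n r) f ≤ ENNReal.ofReal (4 * ((n : ℝ) + 2) ^ (2 * (n + 1))) *
      (normInt n v + ENNReal.ofReal r * normInt (n + 1) w) ^ 2 := by
  -- The constant of `le_lamSum` at n + 1, which also dominates the one at n.
  set c : ℝ := 2 * ((n : ℝ) + 2) ^ (2 * (n + 1)) with hc
  have hc0 : 0 ≤ c := by positivity
  have h1 : wSum ε (kWeight n r) v ≤ ENNReal.ofReal c * normInt n v ^ 2 := by
    rw [normInt_sq ε n hv]
    refine wSum_le ε hc0 (fun j => (kWeight_le_left n r j).trans ((le_lamSum n j).trans ?_)) v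
    refine mul_le_mul_of_nonneg_right ?_ (lamSum_nonneg n j)
    refine mul_le_mul_of_nonneg_left ?_ zero_le_two
    refine (pow_le_pow_left₀ (by positivity) (by linarith : (n : ℝ) + 1 ≤ n + 2) _).trans ?_
    exact pow_le_pow_right₀ (by have : (0 : ℝ) ≤ n := by positivity
                                linarith) (by lia)
  have h2 : wSum ε (kWeight n r) w ≤
      ENNReal.ofReal c * (ENNReal.ofReal r * normInt (n + 1) w) ^ 2 := by
    rw [mul_pow, ← ENNReal.ofReal_pow hr.le, ← mul_assoc, ← ENNReal.ofReal_mul hc0,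
      normInt_sq ε (n + 1) hw]
    refine wSum_le ε (by positivity) (fun j => (kWeight_le_right n r j).trans ?_) w
    rw [mul_comm c, mul_assoc]
    refine mul_le_mul_of_nonneg_left ((le_lamSum (n + 1) j).trans_eq ?_) (sq_nonneg r)
    rw [hc]; push_cast; ring
  have h3 : wSum ε (kWeight n r) f ≤ 2 * (wSum ε (kWeight n r) v + wSum ε (kWeight n r) w) :=
    wSum_le_add ε (kWeight_nonneg n r) fun q => by
      rw [coeff_congr ε hf, coeff_add ε hv hw]
  refine h3.trans ((mul_le_mul_right (add_le_add h1 h2) 2).trans ?_)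
  rw [← mul_add, ← mul_assoc, ← ENNReal.ofReal_ofNat 2, ← ENNReal.ofReal_mul zero_le_two, hc,
    ← mul_assoc 2 2]
  norm_num
  refine mul_le_mul_right ?_ _
  rw [add_sq]
  gcongr
  exact le_self_add

theorem wSum_kWeight_le_Jfun (n : ℕ) {r : ℝ} (hr : 0 < r) (f : ℝ × ℝ → ℝ) :
    wSum ε (kWeight n r) f ≤
      ENNReal.ofReal (4 * ((n : ℝ) + 2) ^ (2 * (n + 1))) * Jfun n r f ^ 2 := by
  set c : ℝ := 4 * ((n : ℝ) + 2) ^ (2 * (n + 1)) with hc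
  have hc0 : 0 < c := by positivity
  have hcn : ENNReal.ofReal c ≠ 0 := (ENNReal.ofReal_pos.2 hc0).ne'
  rw [mul_comm, ← ENNReal.div_le_iff hcn ENNReal.ofReal_ne_top]
  -- Square roots are taken because `Jfun` is an infimum of norms, not of their squares.
  have : (wSum ε (kWeight n r) f / ENNReal.ofReal c) ^ (1 / 2 : ℝ) ≤ Jfun n r f := by
    refine le_iInf₂ fun v w => le_iInf₂ fun hv hw => le_iInf fun hf => ?_
    have h := wSum_kWeight_le_decomposition ε n hr hv.1 hw.1 hf
    rw [mul_comm, ← ENNReal.div_le_iff hcn ENNReal.ofReal_ne_top] at h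
    refine (ENNReal.rpow_le_rpow h (by norm_num)).trans_eq ?_
    rw [← ENNReal.rpow_natCast, ← ENNReal.rpow_mul]
    norm_num
  have h2 := pow_le_pow_left' this 2
  rw [← ENNReal.rpow_natCast, ← ENNReal.rpow_mul] at h2
  norm_num at h2
  exact h2

theorem add_sq_le_four_mul {a b Y : ℝ≥0∞} (ha : a ^ 2 ≤ Y) (hb : b ^ 2 ≤ Y) :
    (a + b) ^ 2 ≤ 4 * Y := by
  have key : ∀ x y : ℝ≥0∞, x ≤ y → y ^ 2 ≤ Y → (x + y) ^ 2 ≤ 4 * Y := fun x y hxy hy =>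
    calc (x + y) ^ 2 ≤ (y + y) ^ 2 := by gcongr
      _ = 4 * y ^ 2 := by ring
      _ ≤ 4 * Y := by gcongr
  rcases le_total a b with h | h
  · exact key a b h hb
  · rw [add_comm]; exact key b a h ha

/-- A near-optimal splitting puts the indices with r(1 + j) ≤ 1 into w and the others into v = f -
w, so each index is charged the smaller of the two terms in the minimum. -/
theorem Jfun_le (n : ℕ) {r : ℝ} (hr : 0 < r) {f : ℝ × ℝ → ℝ} (hf : MemVInt n f) :
    Jfun n r f ^ 2 ≤ ENNReal.ofReal (4 * ((n : ℝ) + 2)) * wSum ε (kWeight n r) f := by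
  obtain ⟨hfL, hft⟩ := (memVInt_iff ε n f).1 hf
  set A : Set (ℕ × ℕ) := {q | r * (1 + (q.2 : ℝ)) ≤ 1} with hA
  obtain ⟨w, hw, hwc⟩ := exists_coeff_indicator ε hfL A
  set X := wSum ε (kWeight n r) f with hX
  have hr2 : (0 : ℝ) < r ^ 2 := by positivity
  have hn0 : (0 : ℝ) ≤ n := by positivity
  -- Finiteness is what later places v and w in the spaces over which the infimum runs.
  have hXt : X < ∞ := by
    refine (wSum_le ε (c := 2 * ((n : ℝ) + 1) ^ (2 * n)) (by positivity)
      (fun j => (kWeight_le_left n r j).trans (le_lamSum n j)) f).trans_lt ?_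
    exact ENNReal.mul_lt_top ENNReal.ofReal_lt_top hft
  have hvL := hfL.sub hw
  have h1 : wSum ε (lamSum n) (f - w) ≤ ENNReal.ofReal ((n : ℝ) + 2) * X := by
    rw [hX, wSum, wSum, ← ENNReal.tsum_mul_left]
    refine ENNReal.tsum_le_tsum fun q => ?_
    rw [← ENNReal.ofReal_mul (by positivity), coeff_sub ε hfL hw, hwc]
    refine ENNReal.ofReal_le_ofReal ?_
    by_cases hq : q ∈ A
    · simp only [indicator_of_mem hq, sub_self]
      have := mul_nonneg (kWeight_nonneg n r q.2) (sq_nonneg (coeff ε f q.1 q.2))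
      simp only [ne_eq, OfNat.ofNat_ne_zero, not_false_eq_true, zero_pow, mul_zero]
      positivity
    · rw [indicator_of_notMem hq, sub_zero, ← mul_assoc]
      refine mul_le_mul_of_nonneg_right ((lamSum_le n q.2).trans ?_) (sq_nonneg _)
      have h1r : 1 < r * (1 + (q.2 : ℝ)) := not_le.1 hq
      rw [kWeight, min_eq_left (by nlinarith), mul_one]
      exact mul_le_mul_of_nonneg_right (by linarith) (by positivity)
  have h2 : ENNReal.ofReal (r ^ 2) * wSum ε (lamSum (n + 1)) w ≤
      ENNReal.ofReal ((n : ℝ) + 2) * X := by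
    rw [hX, wSum, wSum, ← ENNReal.tsum_mul_left, ← ENNReal.tsum_mul_left]
    refine ENNReal.tsum_le_tsum fun q => ?_
    rw [← ENNReal.ofReal_mul hr2.le, ← ENNReal.ofReal_mul (show 0 ≤ (n : ℝ) + 2 by positivity), hwc]
    refine ENNReal.ofReal_le_ofReal ?_
    by_cases hq : q ∈ A
    · rw [indicator_of_mem hq, ← mul_assoc, ← mul_assoc]
      refine mul_le_mul_of_nonneg_right
        ((mul_le_mul_of_nonneg_left (lamSum_le (n + 1) q.2) hr2.le).trans_eq ?_) (sq_nonneg _)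
      have h1r : r * (1 + (q.2 : ℝ)) ≤ 1 := hq
      have h0r : 0 ≤ r * (1 + (q.2 : ℝ)) := by positivity
      rw [kWeight, min_eq_right (by nlinarith)]
      push_cast
      ring
    · have := mul_nonneg (kWeight_nonneg n r q.2) (sq_nonneg (coeff ε f q.1 q.2))
      simp only [indicator_of_notMem hq, ne_eq, OfNat.ofNat_ne_zero, not_false_eq_true, zero_pow,
        mul_zero]
      positivity
  have hYt : ENNReal.ofReal ((n : ℝ) + 2) * X < ∞ := ENNReal.mul_lt_top ENNReal.ofReal_lt_top hXt
  have hvM : MemVInt n (f - w) := (memVInt_iff ε n _).2 ⟨hvL, h1.trans_lt hYt⟩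
  have hwM : MemVInt (n + 1) w := by
    refine (memVInt_iff ε _ _).2 ⟨hw, ?_⟩
    rw [lt_top_iff_ne_top]
    intro h
    rw [h, ENNReal.mul_top (ENNReal.ofReal_pos.2 hr2).ne'] at h2
    exact absurd h2 (not_le.2 hYt)
  have hJ : Jfun n r f ≤ normInt n (f - w) + ENNReal.ofReal r * normInt (n + 1) w :=
    iInf₂_le_of_le (f - w) w (iInf₂_le_of_le hvM hwM (iInf_le _ (by rw [sub_add_cancel])))
  rw [← normInt_sq ε n hvL] at h1
  rw [← normInt_sq ε (n + 1) hw, ENNReal.ofReal_pow hr.le, ← mul_pow] at h2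
  refine (pow_le_pow_left' hJ 2).trans ?_
  rw [ENNReal.ofReal_mul (by norm_num), mul_assoc, ENNReal.ofReal_ofNat]
  exact add_sq_le_four_mul h1 h2

/-- The value of `∫₀^∞ r^{-2κ} min(1, r²) dr / r`. -/
def kConst (κ : ℝ) : ℝ := 1 / (2 - 2 * κ) + 1 / (2 * κ)

theorem kConst_pos {κ : ℝ} (h0 : 0 < κ) (h1 : κ < 1) : 0 < kConst κ :=
  add_pos (one_div_pos.2 (by linarith)) (one_div_pos.2 (by linarith))

/-- The minimum changes branch at r = 1/s. Convergence at 0 needs κ < 1 and convergence at infinity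
needs κ > 0. -/
theorem lintegral_min {κ : ℝ} (h0 : 0 < κ) (h1 : κ < 1) {s : ℝ} (hs : 0 < s) :
    ∫⁻ r in Ioi (0 : ℝ), ENNReal.ofReal (r ^ (-2 * κ) * min 1 ((r * s) ^ 2) * (1 / r)) =
      ENNReal.ofReal (kConst κ * s ^ (2 * κ)) := by
  have hs' : 0 < 1 / s := by positivity
  rw [← Ioc_union_Ioi_eq_Ioi hs'.le, lintegral_union measurableSet_Ioi (Ioc_disjoint_Ioi le_rfl)]
  have e1 : ∫⁻ r in Ioc 0 (1 / s), ENNReal.ofReal (r ^ (-2 * κ) * min 1 ((r * s) ^ 2) * (1 / r)) =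
      ENNReal.ofReal (1 / (2 - 2 * κ) * s ^ (2 * κ)) := by
    have e : ∀ r ∈ Ioc 0 (1 / s), r ^ (-2 * κ) * min 1 ((r * s) ^ 2) * (1 / r) =
        s ^ 2 * r ^ (1 - 2 * κ) := by
      intro r hr
      have hr1 : r * s ≤ 1 := by have := hr.2; rwa [le_div_iff₀ hs] at this
      have hr0 : 0 ≤ r * s := mul_nonneg hr.1.le hs.le
      rw [min_eq_right (by nlinarith), show 1 - 2 * κ = -2 * κ + 1 by ring, Real.rpow_add hr.1,
        Real.rpow_one]
      have := hr.1.ne'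
      field_simp
    rw [setLIntegral_congr_fun measurableSet_Ioc fun r hr => by rw [e r hr]]
    have hi : IntegrableOn (fun r : ℝ => s ^ 2 * r ^ (1 - 2 * κ)) (Ioc 0 (1 / s)) :=
      ((intervalIntegrable_iff_integrableOn_Ioc_of_le hs'.le).1
        (intervalIntegral.intervalIntegrable_rpow' (by linarith))).const_mul _
    rw [← ofReal_integral_eq_lintegral_ofReal hi]
    · rw [integral_const_mul, ← intervalIntegral.integral_of_le hs'.le,
        integral_rpow (Or.inl (by linarith)), Real.zero_rpow (by linarith),
        show 1 - 2 * κ + 1 = 2 - 2 * κ by ring, one_div s, Real.inv_rpow hs.le,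
        Real.rpow_sub hs, Real.rpow_two]
      have := (Real.rpow_pos_of_pos hs (2 * κ)).ne'
      congr 1
      field_simp
      ring
    · filter_upwards [ae_restrict_mem measurableSet_Ioc] with r hr
      exact mul_nonneg (sq_nonneg s) (Real.rpow_nonneg hr.1.le _)
  have e2 : ∫⁻ r in Ioi (1 / s), ENNReal.ofReal (r ^ (-2 * κ) * min 1 ((r * s) ^ 2) * (1 / r)) =
      ENNReal.ofReal (1 / (2 * κ) * s ^ (2 * κ)) := by
    have e : ∀ r ∈ Ioi (1 / s), r ^ (-2 * κ) * min 1 ((r * s) ^ 2) * (1 / r) =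
        r ^ (-2 * κ - 1) := by
      intro r hr
      have hrp : 0 < r := hs'.trans hr
      have hr1 : 1 < r * s := by have := hr; rwa [mem_Ioi, div_lt_iff₀ hs] at this
      rw [min_eq_left (by nlinarith), Real.rpow_sub hrp, Real.rpow_one]
      ring
    rw [setLIntegral_congr_fun measurableSet_Ioi fun r hr => by rw [e r hr]]
    rw [← ofReal_integral_eq_lintegral_ofReal (integrableOn_Ioi_rpow_of_lt (by linarith) hs')]
    · rw [integral_Ioi_rpow_of_lt (by linarith) hs', one_div s, Real.inv_rpow hs.le,
        ← Real.rpow_neg hs.le]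
      congr 1
      rw [show -(-2 * κ - 1 + 1) = 2 * κ by ring, show -2 * κ - 1 + 1 = -(2 * κ) by ring,
        neg_div_neg_eq]
      ring
    · filter_upwards [ae_restrict_mem measurableSet_Ioi] with r hr
      exact Real.rpow_nonneg (hs'.trans hr).le _
  have hsp := Real.rpow_pos_of_pos hs (2 * κ)
  have p1 : 0 < 1 / (2 - 2 * κ) := one_div_pos.2 (by linarith)
  have p2 : 0 < 1 / (2 * κ) := one_div_pos.2 (by linarith)
  rw [e1, e2, ← ENNReal.ofReal_add (by positivity) (by positivity), kConst, add_mul]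

theorem lintegral_wSum_kWeight (n : ℕ) {κ : ℝ} (h0 : 0 < κ) (h1 : κ < 1) (f : ℝ × ℝ → ℝ) :
    ∫⁻ r in Ioi (0 : ℝ), ENNReal.ofReal (r ^ (-2 * κ)) * wSum ε (kWeight n r) f *
        ENNReal.ofReal (1 / r) =
      ENNReal.ofReal (kConst κ) * wSum ε (fun j => (1 + (j : ℝ)) ^ (2 * (n + κ))) f := by
  have e : ∀ r ∈ Ioi (0 : ℝ), ENNReal.ofReal (r ^ (-2 * κ)) * wSum ε (kWeight n r) f *
        ENNReal.ofReal (1 / r) =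
      ∑' q : ℕ × ℕ, ENNReal.ofReal ((1 + (q.2 : ℝ)) ^ (2 * n) * coeff ε f q.1 q.2 ^ 2) *
        ENNReal.ofReal (r ^ (-2 * κ) * min 1 ((r * (1 + (q.2 : ℝ))) ^ 2) * (1 / r)) := by
    intro r hr
    have hrp := Real.rpow_nonneg (le_of_lt hr) (-2 * κ)
    rw [wSum, ← ENNReal.tsum_mul_left, ← ENNReal.tsum_mul_right]
    congr 1
    ext q
    have hk := mul_nonneg (kWeight_nonneg n r q.2) (sq_nonneg (coeff ε f q.1 q.2))
    rw [← ENNReal.ofReal_mul hrp, ← ENNReal.ofReal_mul (mul_nonneg hrp hk),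
      ← ENNReal.ofReal_mul (by positivity), kWeight]
    congr 1
    ring
  rw [setLIntegral_congr_fun measurableSet_Ioi e, lintegral_tsum, wSum, ← ENNReal.tsum_mul_left]
  · congr 1
    ext q
    have hq : 0 < 1 + (q.2 : ℝ) := by positivity
    rw [lintegral_const_mul, lintegral_min h0 h1 hq, ← ENNReal.ofReal_mul (by positivity),
      ← ENNReal.ofReal_mul (kConst_pos h0 h1).le]
    · congr 1
      rw [mul_add, Real.rpow_add hq, ← Real.rpow_natCast (1 + (q.2 : ℝ)) (2 * n)]
      push_cast
      ring
    · fun_prop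
  · intro q
    exact Measurable.aemeasurable (by fun_prop)

theorem normInterp_sq (n : ℕ) (κ : ℝ) (f : ℝ × ℝ → ℝ) :
    normInterp n κ f ^ 2 = ∫⁻ r in Ioi (0 : ℝ),
      ENNReal.ofReal (r ^ (-2 * κ)) * Jfun n r f ^ 2 * ENNReal.ofReal (1 / r) := by
  rw [normInterp, ← ENNReal.rpow_natCast, ← ENNReal.rpow_mul]
  norm_num

theorem normInterp_sq_le (n : ℕ) {κ : ℝ} (h0 : 0 < κ) (h1 : κ < 1) {f : ℝ × ℝ → ℝ}
    (hf : MemVInt n f) :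
    normInterp n κ f ^ 2 ≤ ENNReal.ofReal (4 * ((n : ℝ) + 2) * kConst κ) *
      wSum ε (fun j => (1 + (j : ℝ)) ^ (2 * (n + κ))) f := by
  rw [ENNReal.ofReal_mul (by positivity), mul_assoc, ← lintegral_wSum_kWeight ε n h0 h1,
    ← lintegral_const_mul' _ _ ENNReal.ofReal_ne_top, normInterp_sq]
  refine setLIntegral_mono' measurableSet_Ioi fun r hr => ?_
  calc _ ≤ ENNReal.ofReal (r ^ (-2 * κ)) *
        (ENNReal.ofReal (4 * ((n : ℝ) + 2)) * wSum ε (kWeight n r) f) * ENNReal.ofReal (1 / r) := by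
        gcongr
        exact Jfun_le ε n hr hf
    _ = _ := by ring

theorem le_normInterp_sq (n : ℕ) {κ : ℝ} (h0 : 0 < κ) (h1 : κ < 1) (f : ℝ × ℝ → ℝ) :
    ENNReal.ofReal (kConst κ) * wSum ε (fun j => (1 + (j : ℝ)) ^ (2 * (n + κ))) f ≤
      ENNReal.ofReal (4 * ((n : ℝ) + 2) ^ (2 * (n + 1))) * normInterp n κ f ^ 2 := by
  rw [← lintegral_wSum_kWeight ε n h0 h1, normInterp_sq,
    ← lintegral_const_mul' _ _ ENNReal.ofReal_ne_top]
  refine setLIntegral_mono' measurableSet_Ioi fun r hr => ?_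
  calc _ ≤ ENNReal.ofReal (r ^ (-2 * κ)) *
        (ENNReal.ofReal (4 * ((n : ℝ) + 2) ^ (2 * (n + 1))) * Jfun n r f ^ 2) *
          ENNReal.ofReal (1 / r) := by
        gcongr
        exact wSum_kWeight_le_Jfun ε n hr f
    _ = _ := by ring

end Basis

/-! ### Passage from (1 + j)^{2η} to the L² norm plus j^{2η}, and conclusion -/

section Basis

variable (ε : HilbertBasis ℕ ℝ (Lp ℝ 2 (volume : Measure ℝ)))

theorem le_two_rpow_mul {a : ℝ} (ha : 0 ≤ a) (j : ℕ) :
    (1 + (j : ℝ)) ^ a ≤ 2 ^ a * (1 + (j : ℝ) ^ a) := by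
  have h1 : (1 : ℝ) ≤ 2 ^ a := Real.one_le_rpow (by norm_num) ha
  have hj : 0 ≤ (j : ℝ) ^ a := by positivity
  rcases Nat.eq_zero_or_pos j with rfl | hp
  · simp only [Nat.cast_zero, add_zero, Real.one_rpow] at hj ⊢
    nlinarith
  · have hp' : (1 : ℝ) ≤ j := by exact_mod_cast hp
    have : (1 + (j : ℝ)) ^ a ≤ (2 * j) ^ a :=
      Real.rpow_le_rpow (by positivity) (by linarith) ha
    rw [Real.mul_rpow zero_le_two (by positivity)] at this
    nlinarith

theorem one_add_rpow_le {a : ℝ} (ha : 0 ≤ a) (j : ℕ) :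
    1 + (j : ℝ) ^ a ≤ 2 * (1 + (j : ℝ)) ^ a := by
  have h1 : (1 : ℝ) ≤ (1 + (j : ℝ)) ^ a := Real.one_le_rpow (by simp) ha
  have h2 : (j : ℝ) ^ a ≤ (1 + (j : ℝ)) ^ a := Real.rpow_le_rpow (by positivity) (by simp) ha
  linarith

theorem eLpNorm_add_coeffSum (η : ℝ) {f : ℝ × ℝ → ℝ} (hf : MemLp f 2 μS) :
    eLpNorm f 2 μS ^ 2 + coeffSum ε η f = wSum ε (fun j => 1 + (j : ℝ) ^ (2 * η)) f := by
  rw [wSum_add ε (fun _ => zero_le_one) (fun _ => by positivity), wSum_one ε hf]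
  simp only [coeffSum, wSum, mul_comm]

theorem wSum_le_eLpNorm_add_coeffSum {η : ℝ} (hη : 0 ≤ η) {f : ℝ × ℝ → ℝ} (hf : MemLp f 2 μS) :
    wSum ε (fun j => (1 + (j : ℝ)) ^ (2 * η)) f ≤
      ENNReal.ofReal (2 ^ (2 * η)) * (eLpNorm f 2 μS ^ 2 + coeffSum ε η f) := by
  rw [eLpNorm_add_coeffSum ε η hf]
  exact wSum_le ε (by positivity) (le_two_rpow_mul (by positivity)) f

theorem eLpNorm_add_coeffSum_le {η : ℝ} (hη : 0 ≤ η) {f : ℝ × ℝ → ℝ} (hf : MemLp f 2 μS) :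
    eLpNorm f 2 μS ^ 2 + coeffSum ε η f ≤
      ENNReal.ofReal 2 * wSum ε (fun j => (1 + (j : ℝ)) ^ (2 * η)) f := by
  rw [eLpNorm_add_coeffSum ε η hf]
  exact wSum_le ε zero_le_two (one_add_rpow_le (by positivity)) f

theorem coeffSum_lt_top_iff {η : ℝ} (hη : 0 ≤ η) {f : ℝ × ℝ → ℝ} (hf : MemLp f 2 μS) :
    coeffSum ε η f < ∞ ↔ wSum ε (fun j => (1 + (j : ℝ)) ^ (2 * η)) f < ∞ := by
  constructor
  · intro h
    refine (wSum_le_eLpNorm_add_coeffSum ε hη hf).trans_lt ?_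
    exact ENNReal.mul_lt_top ENNReal.ofReal_lt_top
      (ENNReal.add_lt_top.2 ⟨ENNReal.pow_lt_top hf.2, h⟩)
  · intro h
    refine le_add_self.trans_lt ((eLpNorm_add_coeffSum_le ε hη hf).trans_lt ?_)
    exact ENNReal.mul_lt_top ENNReal.ofReal_lt_top h

theorem lt_top_of_ofReal_mul_le {X Y : ℝ≥0∞} {c : ℝ} (hc : 0 < c)
    (h : ENNReal.ofReal c * X ≤ Y) (hY : Y < ∞) : X < ∞ := by
  rw [lt_top_iff_ne_top]
  rintro rfl
  rw [ENNReal.mul_top (ENNReal.ofReal_pos.2 hc).ne'] at h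
  exact absurd h (not_le.2 hY)

theorem wSum_natCast (n : ℕ) (f : ℝ × ℝ → ℝ) :
    wSum ε (fun j => (1 + (j : ℝ)) ^ (2 * (n : ℝ))) f =
      wSum ε (fun j => (1 + (j : ℝ)) ^ (2 * n)) f := by
  congr 1
  ext j
  rw [← Real.rpow_natCast]
  push_cast
  rfl

theorem wSum_le_lamSum (n : ℕ) (f : ℝ × ℝ → ℝ) :
    wSum ε (fun j => (1 + (j : ℝ)) ^ (2 * n)) f ≤
      ENNReal.ofReal (2 * ((n : ℝ) + 1) ^ (2 * n)) * wSum ε (lamSum n) f :=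
  wSum_le ε (by positivity) (le_lamSum n) f

theorem wSum_lamSum_le (n : ℕ) (f : ℝ × ℝ → ℝ) :
    wSum ε (lamSum n) f ≤
      ENNReal.ofReal ((n : ℝ) + 1) * wSum ε (fun j => (1 + (j : ℝ)) ^ (2 * n)) f :=
  wSum_le ε (by positivity) (lamSum_le n) f

/-- The constants are fixed before the basis and f, so they depend on η only. Having one on each
side of the lower bound avoids division in [0, ∞]. -/
theorem normV_equiv {η : ℝ} (hη : 0 ≤ η) : ∃ c₁ c₂ c₃ : ℝ, 0 < c₁ ∧ 0 < c₂ ∧ 0 < c₃ ∧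
    ∀ (ε : HilbertBasis ℕ ℝ (Lp ℝ 2 (volume : Measure ℝ))) (f : ℝ × ℝ → ℝ), MemLp f 2 μS →
      (MemV η f ↔ wSum ε (fun j => (1 + (j : ℝ)) ^ (2 * η)) f < ∞) ∧
      (MemV η f →
        ENNReal.ofReal c₁ * wSum ε (fun j => (1 + (j : ℝ)) ^ (2 * η)) f ≤
          ENNReal.ofReal c₂ * normV η f ^ 2 ∧
        normV η f ^ 2 ≤
          ENNReal.ofReal c₃ * wSum ε (fun j => (1 + (j : ℝ)) ^ (2 * η)) f) := by
  set n := ⌊η⌋₊ with hn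
  by_cases h : η = (n : ℝ)
  · refine ⟨1, 2 * ((n : ℝ) + 1) ^ (2 * n), (n : ℝ) + 1, one_pos, by positivity, by positivity,
      fun ε f hf => ?_⟩
    simp only [MemV, normV, ← hn, if_pos h]
    rw [memVInt_iff ε, normInt_sq ε n hf]
    have e : wSum ε (fun j => (1 + (j : ℝ)) ^ (2 * η)) f =
        wSum ε (fun j => (1 + (j : ℝ)) ^ (2 * n)) f := by
      rw [h]; exact wSum_natCast ε n f
    rw [e, ENNReal.ofReal_one, one_mul]
    refine ⟨⟨fun h => ?_, fun h => ⟨hf, ?_⟩⟩, fun _ => ⟨wSum_le_lamSum ε n f, wSum_lamSum_le ε n f⟩⟩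
    · exact (wSum_le_lamSum ε n f).trans_lt (ENNReal.mul_lt_top ENNReal.ofReal_lt_top h.2)
    · exact (wSum_lamSum_le ε n f).trans_lt (ENNReal.mul_lt_top ENNReal.ofReal_lt_top h)
  · set κ := η - n with hκ
    have h0 : 0 < κ := sub_pos.2 ((Nat.floor_le hη).lt_of_ne (Ne.symm h))
    have h1 : κ < 1 := by have := Nat.lt_floor_add_one η; rw [hκ]; linarith
    have hk := kConst_pos h0 h1
    have eη : (n : ℝ) + κ = η := by rw [hκ]; ring
    refine ⟨kConst κ, 4 * ((n : ℝ) + 2) ^ (2 * (n + 1)), 4 * ((n : ℝ) + 2) * kConst κ, hk,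
      by positivity, by positivity, fun ε f hf => ?_⟩
    simp only [MemV, normV, ← hn, if_neg h, ← hκ]
    have hle := le_normInterp_sq ε n h0 h1 f
    rw [eη] at hle
    have hge : MemVInt n f → normInterp n κ f ^ 2 ≤ _ := normInterp_sq_le ε n h0 h1
    rw [eη] at hge
    refine ⟨⟨fun hm => ?_, fun hW => ?_⟩, fun hm => ⟨hle, hge hm.1⟩⟩
    · exact lt_top_of_ofReal_mul_le hk hle
        (ENNReal.mul_lt_top ENNReal.ofReal_lt_top (ENNReal.pow_lt_top hm.2))
    -- Membership in the space of order n is part of the definition; it follows from n ≤ η, as 1 + j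
    -- ≥ 1.
    · have hm : MemVInt n f := by
        refine (memVInt_iff ε n f).2 ⟨hf, (wSum_lamSum_le ε n f).trans_lt
          (ENNReal.mul_lt_top ENNReal.ofReal_lt_top ?_)⟩
        refine lt_of_le_of_lt ?_ hW
        rw [← wSum_natCast]
        refine (wSum_le ε zero_le_one (fun j => ?_) f).trans_eq
          (by rw [ENNReal.ofReal_one, one_mul])
        rw [one_mul]
        exact Real.rpow_le_rpow_of_exponent_le (by simp) (by linarith)
      refine ⟨hm, ?_⟩
      have := (hge hm).trans_lt (ENNReal.mul_lt_top ENNReal.ofReal_lt_top hW)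
      rw [lt_top_iff_ne_top] at this ⊢
      exact fun h => this (by simp [h])

theorem tsum_ofReal_lt_top_iff {ι : Type*} {u : ι → ℝ} (hu : ∀ i, 0 ≤ u i) :
    ∑' i, ENNReal.ofReal (u i) < ∞ ↔ Summable u := by
  constructor
  · intro h
    have := ENNReal.summable_toReal h.ne
    simpa only [ENNReal.toReal_ofReal (hu _)] using this
  · intro h
    rw [← ENNReal.ofReal_tsum_of_nonneg hu h]
    exact ENNReal.ofReal_lt_top

theorem wSum_lam_lt_top_iff (n : ℕ) {f : ℝ × ℝ → ℝ} (hf : MemLp f 2 μS) :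
    wSum ε (lam n) f < ∞ ↔ ∃ g, IsWeakDerivX n f g ∧ weightedSq n g < ∞ := by
  constructor
  · intro h
    obtain ⟨g, hg, he⟩ := exists_isWeakDerivX ε hf (n := n) h.ne
    exact ⟨g, hg, by rw [he]; exact h⟩
  · rintro ⟨g, hg, h⟩
    exact (hg.tsum_le ε hf).trans_lt h

theorem weightedSq_lt_top_iff {n : ℕ} {f g : ℝ × ℝ → ℝ} (hg : IsWeakDerivX n f g) :
    weightedSq n g < ∞ ↔
      MemLp (fun p : ℝ × ℝ => g p * (1 - p.1 ^ 2) ^ ((n : ℝ) / 2)) 2 μS := by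
  have e : (fun p : ℝ × ℝ => g p * (1 - p.1 ^ 2) ^ ((n : ℝ) / 2)) =ᵐ[μS]
      fun p : ℝ × ℝ => g p * √(1 - p.1 ^ 2) ^ n := by
    filter_upwards [ae_μS] with p hp
    have h0 : 0 ≤ 1 - p.1 ^ 2 := by nlinarith [hp.1, hp.2]
    rw [Real.sqrt_eq_rpow, ← Real.rpow_natCast _ n, ← Real.rpow_mul h0, one_div_mul_eq_div]
  rw [memLp_congr_ae e]
  refine ⟨hg.memLp_weight, fun h => ?_⟩
  rw [weightedSq_eq]
  exact ENNReal.pow_lt_top h.2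

theorem memℓp_iff (n : ℕ) (f : ℝ × ℝ → ℝ) :
    Memℓp (fun q : ℕ × ℕ => coeff ε f q.1 q.2 * (q.2 : ℝ) ^ n) 2 ↔
      Summable fun q : ℕ × ℕ => coeff ε f q.1 q.2 ^ 2 * (q.2 : ℝ) ^ (2 * n) := by
  rw [memℓp_gen_iff (by norm_num)]
  refine summable_congr fun q => ?_
  rw [ENNReal.toReal_ofNat, Real.rpow_two, Real.norm_eq_abs, sq_abs, mul_pow, ← pow_mul, mul_comm n]

theorem summable_iff_coeffSum (n : ℕ) (f : ℝ × ℝ → ℝ) :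
    (Summable fun q : ℕ × ℕ => coeff ε f q.1 q.2 ^ 2 * (q.2 : ℝ) ^ (2 * n)) ↔
      coeffSum ε n f < ∞ := by
  rw [← tsum_ofReal_lt_top_iff fun q => by positivity, coeffSum]
  simp only [← Real.rpow_natCast _ (2 * n)]
  push_cast
  rfl

theorem injective_prod_coe (n : ℕ) :
    Function.Injective fun q : ℕ × {j : ℕ // n ≤ j} => (q.1, (q.2 : ℕ)) := by
  rintro ⟨a, b⟩ ⟨c, d⟩ h
  simpa [Subtype.ext_iff] using h

theorem wSum_lam_lt_top_of_summable (n : ℕ) {f : ℝ × ℝ → ℝ}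
    (h : Summable fun q : ℕ × {j : ℕ // n ≤ j} =>
      coeff ε f q.1 q.2 ^ 2 * ((q.2 : ℕ) : ℝ) ^ (2 * n)) : wSum ε (lam n) f < ∞ := by
  rw [wSum, tsum_ofReal_lt_top_iff fun q => mul_nonneg (lam_nonneg _ _) (sq_nonneg _),
    ← (injective_prod_coe n).summable_iff]
  · refine Summable.of_nonneg_of_le
      (fun q => mul_nonneg (lam_nonneg _ _) (sq_nonneg _)) (fun q => ?_) (h.mul_left (2 ^ (2 * n)))
    rcases q with ⟨k, j, hj⟩
    have key : lam n j ≤ 2 ^ (2 * n) * (j : ℝ) ^ (2 * n) := by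
      rcases Nat.eq_zero_or_pos j with rfl | hp
      -- Here n ≤ j = 0, and the bound is 1 ≤ 1 thanks to 0^0 = 1.
      · obtain rfl : n = 0 := by lia
        simp [lam_zero]
      · have hp' : (1 : ℝ) ≤ j := by exact_mod_cast hp
        rw [← mul_pow]
        exact (lam_le n j).trans (pow_le_pow_left₀ (by positivity) (by linarith) _)
    simp only [Function.comp]
    rw [mul_comm, mul_left_comm]
    exact mul_le_mul_of_nonneg_left key (sq_nonneg _)
  · rintro ⟨k, j⟩ hq
    have : j < n := by
      by_contra hj
      exact hq ⟨(k, ⟨j, not_lt.1 hj⟩), rfl⟩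
    simp only [lam_eq_zero this, zero_mul]

/-- The indices j < n are invisible to `lam n`; they are recovered from the L² norm of f. -/
theorem coeffSum_lt_top_of_wSum_lam (n : ℕ) {f : ℝ × ℝ → ℝ} (hf : MemLp f 2 μS)
    (h : wSum ε (lam n) f < ∞) : coeffSum ε n f < ∞ := by
  rw [coeffSum_lt_top_iff ε (by positivity) hf, wSum_natCast]
  refine (wSum_le ε (by positivity) (le_one_add_lam n) f).trans_lt ?_
  rw [wSum_add ε (fun _ => zero_le_one) (lam_nonneg n), wSum_one ε hf]
  exact ENNReal.mul_lt_top ENNReal.ofReal_lt_top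
    (ENNReal.add_lt_top.2 ⟨ENNReal.pow_lt_top hf.2, h⟩)

theorem weakDeriv_tfae (n : ℕ) {f : ℝ × ℝ → ℝ} (hf : MemLp f 2 μS) :
    List.TFAE [
      Memℓp (fun q : ℕ × ℕ => coeff ε f q.1 q.2 * (q.2 : ℝ) ^ n) 2,
      Summable (fun q : ℕ × {j : ℕ // n ≤ j} =>
        coeff ε f q.1 q.2 ^ 2 * ((q.2 : ℕ) : ℝ) ^ (2 * n)),
      ∃ g : ℝ × ℝ → ℝ, IsWeakDerivX n f g ∧
        MemLp (fun p : ℝ × ℝ => g p * (1 - p.1 ^ 2) ^ ((n : ℝ) / 2)) 2 μS,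
      ∃ g : ℝ × ℝ → ℝ, IsWeakDerivX n f g ∧ weightedSq n g < ∞] := by
  tfae_have 1 → 2 := by
    intro h
    have := ((memℓp_iff ε n f).1 h).comp_injective (injective_prod_coe n)
    simpa only [Function.comp_def] using this
  tfae_have 2 → 4 := fun h =>
    (wSum_lam_lt_top_iff ε n hf).1 (wSum_lam_lt_top_of_summable ε n h)
  tfae_have 4 → 1 := fun h => (memℓp_iff ε n f).2 ((summable_iff_coeffSum ε n f).2
    (coeffSum_lt_top_of_wSum_lam ε n hf ((wSum_lam_lt_top_iff ε n hf).2 h)))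
  tfae_have 3 ↔ 4 :=
    exists_congr fun g => and_congr_right fun hg => (weightedSq_lt_top_iff hg).symm
  tfae_finish

theorem normV_sq_equiv {η : ℝ} (hη : 0 ≤ η) : ∃ c C : ℝ≥0, 0 < c ∧ 0 < C ∧
    ∀ (ε : HilbertBasis ℕ ℝ (Lp ℝ 2 (volume : Measure ℝ))) (f : ℝ × ℝ → ℝ), MemLp f 2 μS →
      (MemV η f ↔ coeffSum ε η f < ∞) ∧
      (MemV η f →
        (c : ℝ≥0∞) * (eLpNorm f 2 μS ^ 2 + coeffSum ε η f) ≤ normV η f ^ 2 ∧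
        normV η f ^ 2 ≤ (C : ℝ≥0∞) * (eLpNorm f 2 μS ^ 2 + coeffSum ε η f)) := by
  obtain ⟨c₁, c₂, c₃, h1, h2, h3, H⟩ := normV_equiv hη
  have h4 : (0 : ℝ) < c₁ / (2 * c₂) := by positivity
  have h5 : (0 : ℝ) < c₃ * 2 ^ (2 * η) := by positivity
  refine ⟨(c₁ / (2 * c₂)).toNNReal, (c₃ * 2 ^ (2 * η)).toNNReal, Real.toNNReal_pos.2 h4,
    Real.toNNReal_pos.2 h5, fun ε f hf => ?_⟩
  obtain ⟨hiff, hle⟩ := H ε f hf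
  refine ⟨hiff.trans (coeffSum_lt_top_iff ε hη hf).symm, fun hm => ?_⟩
  obtain ⟨ha, hb⟩ := hle hm
  change ENNReal.ofReal _ * _ ≤ _ ∧ _ ≤ ENNReal.ofReal _ * _
  constructor
  · calc _ ≤ ENNReal.ofReal (c₁ / (2 * c₂)) *
          (ENNReal.ofReal 2 * wSum ε (fun j => (1 + (j : ℝ)) ^ (2 * η)) f) := by
          gcongr; exact eLpNorm_add_coeffSum_le ε hη hf
      _ = ENNReal.ofReal (1 / c₂) *
          (ENNReal.ofReal c₁ * wSum ε (fun j => (1 + (j : ℝ)) ^ (2 * η)) f) := by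
          rw [← mul_assoc, ← mul_assoc, ← ENNReal.ofReal_mul h4.le,
            ← ENNReal.ofReal_mul (by positivity)]
          congr 2
          field_simp
      _ ≤ ENNReal.ofReal (1 / c₂) * (ENNReal.ofReal c₂ * normV η f ^ 2) := by gcongr
      _ = normV η f ^ 2 := by
          rw [← mul_assoc, ← ENNReal.ofReal_mul (by positivity), one_div_mul_cancel h2.ne',
            ENNReal.ofReal_one, one_mul]
  · refine hb.trans ?_
    rw [ENNReal.ofReal_mul h3.le, mul_assoc]
    gcongr
    exact wSum_le_eLpNorm_add_coeffSum ε hη hf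

end Basis

end KLReg

end

theorem mainTheorem2 :
    (∀ η : ℝ, 0 ≤ η → ∃ c C : ℝ≥0, 0 < c ∧ 0 < C ∧
      ∀ (ε : HilbertBasis ℕ ℝ (Lp ℝ 2 (volume : Measure ℝ))) (f : ℝ × ℝ → ℝ),
        MemLp f 2 KLReg.μS →
          (KLReg.MemV η f ↔ KLReg.coeffSum ε η f < ∞) ∧
          (KLReg.MemV η f →
            (c : ℝ≥0∞) * (eLpNorm f 2 KLReg.μS ^ 2 + KLReg.coeffSum ε η f) ≤ KLReg.normV η f ^ 2 ∧
            KLReg.normV η f ^ 2 ≤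
              (C : ℝ≥0∞) * (eLpNorm f 2 KLReg.μS ^ 2 + KLReg.coeffSum ε η f))) ∧
    (∀ (n : ℕ) (ε : HilbertBasis ℕ ℝ (Lp ℝ 2 (volume : Measure ℝ))) (f : ℝ × ℝ → ℝ),
      MemLp f 2 KLReg.μS →
        List.TFAE [
          Memℓp (fun q : ℕ × ℕ => KLReg.coeff ε f q.1 q.2 * (q.2 : ℝ) ^ n) 2,
          Summable (fun q : ℕ × {j : ℕ // n ≤ j} =>
            KLReg.coeff ε f q.1 q.2 ^ 2 * ((q.2 : ℕ) : ℝ) ^ (2 * n)),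
          ∃ g : ℝ × ℝ → ℝ, KLReg.IsWeakDerivX n f g ∧
            MemLp (fun p : ℝ × ℝ => g p * (1 - p.1 ^ 2) ^ ((n : ℝ) / 2)) 2 KLReg.μS,
          ∃ g : ℝ × ℝ → ℝ, KLReg.IsWeakDerivX n f g ∧ KLReg.weightedSq n g < ∞]) :=
  ⟨fun _ hη => KLReg.normV_sq_equiv hη, fun n ε _ hf => KLReg.weakDeriv_tfae ε n hf⟩
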